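/- Fix an integer $l\ge 1$. For $\mathbf n=(n_0,\dots,n_{l-1})^T\in\mathbb N^l$ put $|\mathbf n|=\sum_i n_i$, and let $\mathbf e_i$ be the coordinate vectors. A vector composition is a finite (possibly empty) sequence $\mathbf I=(\mathbf i_1,\dots,\mathbf i_m)$ of nonzero columns in $\mathbb N^l$; put $\ell(\mathbf I)=m$, $\Sigma\mathbf I=\sum_r\mathbf i_r$, $|\mathbf I|=\sum_r|\mathbf i_r|$, and $D(\mathbf I)=\{|\mathbf i_1|,|\mathbf i_1|+|\mathbf i_2|,\dots,|\mathbf i_1|+\cdots+|\mathbf i_{m-1}|\}$. The coloring word of $\mathbf I$ is obtained by reading down each column, from the left-most column to the right-most one, and recording $\mathbf I_{i,j}$ copies of the color $i$ at the entry $\mathbf I_{i,j}$; for a word $u=u_1\cdots u_n$ in $\{0,\dots,l-1\}$ let $\mathbf E_u=(\mathbf e_{u_1},\dots,\mathbf e_{u_n})$. Write $\mathbf I\trianglelefteq\mathbf J$ if $\mathbf J=\mathbf J_1\cdots\mathbf J_m$ is a concatenation of vector compositions with $\Sigma\mathbf J_k=\mathbf i_k$ for all $k$, and $\mathbf I\preccurlyeq\mathbf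 J$ if moreover, within each $\mathbf J_k$, every element of the support of a column is at most every element of the support of each column further to the right. Let $\mathrm{QSym}^{(l)}$ be the $\mathbb N^l$-graded algebra of quasisymmetric functions of level $l$ over $\mathbb Q$: the formal power series of finite degree in the commuting variables $x^{(i)}_j$ ($0\le i<l$, $j\ge1$) in which the coefficients of $\mathbf x_1^{\mathbf i_1}\cdots\mathbf x_m^{\mathbf i_m}$ and of $\mathbf x_{j_1}^{\mathbf i_1}\cdots\mathbf x_{j_m}^{\mathbf i_m}$ are equal for every vector composition $(\mathbf i_1,\dots,\mathbf i_m)$ and all $j_1<\cdots<j_m$, where $\mathbf x_j^{\mathbf n}=\prod_i (x_j^{(i)})^{n_i}$. It has the basis $M_{\mathbf I}=\sum_{j_1<\cdots<j_m}\mathbf x_{j_1}^{\mathbf i_1}\cdots\mathbf x_{j_m}^{\mathbf i_m}$, with $M_{()}=1$. Put $F_{\mathbf I}=\sum_{\mathbf I\preccurlyeq\mathbf J}M_{\mathbf J}$ and $\eta_{\mathbf I}=\sum_{\mathbf J\trianglelefteq\mathbf I}2^{\ell(\mathbf J)}M_{\mathbf J}$. The coproduct is $\Delta(M_{\mathbf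 I})=\sum_{\mathbf I=\mathbf J\mathbf K}M_{\mathbf J}\otimes M_{\mathbf K}$, the counit is the projection onto degree $\mathbf 0$, and $S$ denotes the antipode, that is, the convolution inverse of the identity. Let $\zeta:\mathrm{QSym}^{(l)}\to\mathbb Q$ be the character that sets all $x_1^{(i)}$ equal to $1$ and all other variables equal to $0$; let $\bar\zeta(h)=(-1)^{|\mathbf n|}\zeta(h)$ for $h$ homogeneous of multidegree $\mathbf n$; and let $\nu=(\bar\zeta\circ S)\,\zeta$ (convolution product). If the last column of $\mathbf I$ has odd weight, write $\mathbf I=\mathbf I_1\cdots\mathbf I_m$, where the last column of each $\mathbf I_j$ has odd weight and all its other columns have even weight, and let $\mathrm{odd}(\mathbf I)=(\Sigma\mathbf I_1,\dots,\Sigma\mathbf I_m)$. For arbitrary $\mathbf I$, write $\mathbf I=\mathbf I_1\cdots\mathbf I_m$, where each $\mathbf I_j$ with $j\ne m$ is a (possibly empty) sequence of coordinate vectors followed by one column of weight $\ne1$, and $\mathbf I_m$ is a (possibly empty) sequence of coordinate vectors; let $\Lambda(\mathbf I)=(\Sigma\mathbf I_1,\dots,\Sigma\mathbf I_m)$, the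 last column being omitted if $\mathbf I_m$ is empty, and let $\mathrm{Peak}(\mathbf I)=D(\Lambda(\mathbf I))$. There is a unique morphism of $\mathbb N^l$-graded coalgebras $\Theta:\mathrm{QSym}^{(l)}\to\mathrm{QSym}^{(l)}$ with $\zeta\circ\Theta=\nu$ (the level-$l$ descents-to-peaks map), and for every vector composition $\mathbf I$ it satisfies $$\Theta(M_{\mathbf I})=\begin{cases}1&\text{if }\mathbf I=(\,),\\(-1)^{\ell(\mathbf I)+|\mathbf I|}\,\eta_{\mathrm{odd}(\mathbf I)}&\text{if the last column of }\mathbf I\text{ has odd weight},\\0&\text{otherwise,}\end{cases}$$ and, if $u$ is the coloring word of $\mathbf I$, $$\Theta(F_{\mathbf I})=\sum_{\substack{\mathbf J\trianglelefteq\mathbf E_u\\ \mathrm{Peak}(\mathbf I)\subseteq D(\mathbf J)\cup(D(\mathbf J)+1)}}2^{\ell(\mathbf J)}M_{\mathbf J},$$ where $D(\mathbf J)+1=\{s+1: s\in D(\mathbf J)\}$. -/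

import Mathlib

open scoped Classical TensorProduct

noncomputable section

/-! ### Vector compositions -/

/-- A vector composition of level `l`: a finite sequence of nonzero columns in `ℕ^l`. -/
@[ext]
structure VecComp (l : ℕ) where
  cols : List (Fin l → ℕ)
  ne_zero : ∀ v ∈ cols, v ≠ 0

namespace VecComp

variable {l : ℕ}

/-- The weight `n_0 + ⋯ + n_{l-1}` of an `l`-partite number. -/
def wt (v : Fin l → ℕ) : ℕ := ∑ i, v i

/-- The empty vector composition. -/
def empty : VecComp l := ⟨[], by simp⟩

/-- The length (number of columns). -/
def len (I : VecComp l) : ℕ := I.cols.length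

/-- The weight `|I|`. -/
def weight (I : VecComp l) : ℕ := (I.cols.map wt).sum

/-- `ΣI`, the sum of the columns. -/
def total (I : VecComp l) : Fin l → ℕ := I.cols.sum

/-- The first `k` columns of `I`. -/
def take (k : ℕ) (I : VecComp l) : VecComp l :=
  ⟨I.cols.take k, fun v hv => I.ne_zero v (List.mem_of_mem_take hv)⟩

/-- `I` without its first `k` columns. -/
def drop (k : ℕ) (I : VecComp l) : VecComp l :=
  ⟨I.cols.drop k, fun v hv => I.ne_zero v (List.mem_of_mem_drop hv)⟩

/-- `I ⊴ J`: `J` is a refinement of `I`, i.e. `J` is a concatenation `J_1 ⋯ J_m` with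
`J_k` a vector composition of the `k`-th column of `I`. -/
def Refines (I J : VecComp l) : Prop :=
  ∃ Js : List (VecComp l), J.cols = (Js.map cols).flatten ∧ I.cols = Js.map total

/-- Supports weakly increase: every element of the support of a column is `≤` every element of the
support of every column further to the right. -/
def SuppIncreasing (J : VecComp l) : Prop :=
  J.cols.Pairwise fun v w => ∀ p q : Fin l, v p ≠ 0 → w q ≠ 0 → p ≤ q

/-- `I ≼ J`: a refinement in which each `J_k` has weakly increasing supports. -/
def ColorRefines (I J : VecComp l) : Prop :=
  ∃ Js : List (VecComp l), J.cols = (Js.map cols).flatten ∧ I.cols = Js.map total ∧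
    ∀ K ∈ Js, K.SuppIncreasing

/-- `D(I) = {|i_1|, |i_1| + |i_2|, …, |i_1| + ⋯ + |i_{m-1}|}`. -/
def desSet (I : VecComp l) : Finset ℕ :=
  (Finset.Ico 1 I.len).image fun k => (I.take k).weight

/-- The coloring word of `I`: reading down each column, from left to right, record `I_{i,j}` copies
of the color `i`. -/
def colorWord (I : VecComp l) : List (Fin l) :=
  I.cols.flatMap fun v => (List.finRange l).flatMap fun i => List.replicate (v i) i

/-- `E_u = (e_{u_1}, …, e_{u_n})`. -/
def coord (u : List (Fin l)) : VecComp l :=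
  ⟨u.map fun i => Pi.single i 1, by simp⟩

/-- The last column of `I` exists and has odd weight. -/
def LastOdd (I : VecComp l) : Prop := ∃ v ∈ I.cols.getLast?, Odd (wt v)

/-- Read the columns from left to right, keeping in `acc` the sum of the columns of the current
block, and close a block after each column of odd weight; return the list of block sums. (Columns
after the last odd one are ignored; there are none when the last column has odd weight.) -/
def oddCols (acc : Fin l → ℕ) : List (Fin l → ℕ) → List (Fin l → ℕ)
  | [] => []
  | v :: t => if Odd (wt v) then (acc + v) :: oddCols 0 t else oddCols (acc + v) t

theorem add_ne_zero_right (a : Fin l → ℕ) {v : Fin l → ℕ} (hv : v ≠ 0) : a + v ≠ 0 := by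
  intro h
  apply hv
  funext i
  have := congrFun h i
  simp only [Pi.add_apply, Pi.zero_apply] at this ⊢
  omega

theorem oddCols_ne_zero (t : List (Fin l → ℕ)) :
    ∀ acc : Fin l → ℕ, (∀ v ∈ t, v ≠ 0) → ∀ w ∈ oddCols acc t, w ≠ 0 := by
  induction t with
  | nil => intro acc _ w hw; simp [oddCols] at hw
  | cons v t ih =>
    intro acc h w hw
    have hv := h v (by simp)
    have ht : ∀ v ∈ t, v ≠ 0 := fun u hu => h u (by simp [hu])
    unfold oddCols at hw
    split_ifs at hw
    · rcases List.mem_cons.1 hw with rfl | hw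
      · exact add_ne_zero_right _ hv
      · exact ih _ ht w hw
    · exact ih _ ht w hw

/-- `odd(I) = (ΣI_1, …, ΣI_m)`, where `I = I_1 ⋯ I_m` and the last column of each `I_j` has odd
weight while all its other columns have even weight. -/
def odd (I : VecComp l) : VecComp l := ⟨oddCols 0 I.cols, oddCols_ne_zero _ _ I.ne_zero⟩

/-- Read the columns from left to right, keeping in `acc` the sum of the columns of the current
block, and close a block after each column of weight `≠ 1`, and at the end if the last block is
nonempty; return the list of block sums. -/
def peakCols (acc : Fin l → ℕ) : List (Fin l → ℕ) → List (Fin l → ℕ)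
  | [] => if acc = 0 then [] else [acc]
  | v :: t => if wt v ≠ 1 then (acc + v) :: peakCols 0 t else peakCols (acc + v) t

theorem peakCols_ne_zero (t : List (Fin l → ℕ)) :
    ∀ acc : Fin l → ℕ, (∀ v ∈ t, v ≠ 0) → ∀ w ∈ peakCols acc t, w ≠ 0 := by
  induction t with
  | nil =>
    intro acc _ w hw
    unfold peakCols at hw
    split_ifs at hw with h
    · simp at hw
    · simp only [List.mem_singleton] at hw
      rw [hw]; exact h
  | cons v t ih =>
    intro acc h w hw
    have hv := h v (by simp)
    have ht : ∀ v ∈ t, v ≠ 0 := fun u hu => h u (by simp [hu])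
    unfold peakCols at hw
    split_ifs at hw
    · rcases List.mem_cons.1 hw with rfl | hw
      · exact add_ne_zero_right _ hv
      · exact ih _ ht w hw
    · exact ih _ ht w hw

/-- The peak vector composition `Λ(I) = (ΣI_1, …, ΣI_m)`, where `I = I_1 ⋯ I_m`, each `I_j` with
`j ≠ m` is a sequence of coordinate vectors followed by one column of weight `≠ 1`, and `I_m` is a
sequence of coordinate vectors (contributing no column if it is empty). -/
def peakComp (I : VecComp l) : VecComp l :=
  ⟨peakCols 0 I.cols, peakCols_ne_zero _ _ I.ne_zero⟩

/-- `Peak(I) = D(Λ(I))`. -/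
def peakSet (I : VecComp l) : Finset ℕ := I.peakComp.desSet

/-! Finiteness of the set of vector compositions of bounded weight -/

theorem one_le_wt {v : Fin l → ℕ} (hv : v ≠ 0) : 1 ≤ wt v := by
  by_contra h
  apply hv
  have h0 : ∑ i, v i = 0 := by unfold wt at h; omega
  funext i
  exact (Finset.sum_eq_zero_iff.1 h0) i (Finset.mem_univ i)

theorem len_le_weight (I : VecComp l) : I.len ≤ I.weight := by
  have : ∀ L : List (Fin l → ℕ), (∀ v ∈ L, v ≠ 0) → L.length ≤ (L.map wt).sum := by
    intro L
    induction L with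
    | nil => simp
    | cons v t ih =>
      intro h
      have h1 := one_le_wt (h v (by simp))
      have h2 := ih fun u hu => h u (by simp [hu])
      simp only [List.length_cons, List.map_cons, List.sum_cons]
      omega
  exact this _ I.ne_zero

theorem finite_weight_le (N : ℕ) : {I : VecComp l | I.weight ≤ N}.Finite := by
  let g : (Fin l → Fin (N + 1)) → (Fin l → ℕ) := fun v i => (v i : ℕ)
  have hfin := (List.finite_length_le (Fin l → Fin (N + 1)) N).image (List.map g)
  refine Set.Finite.of_finite_image (f := cols) (hfin.subset ?_) ?_
  · rintro _ ⟨I, hI, rfl⟩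
    refine ⟨I.cols.map fun v i => Fin.ofNat (N + 1) (v i), ?_, ?_⟩
    · have := I.len_le_weight
      simp only [Set.mem_ofPred_eq, List.length_map] at hI ⊢
      exact this.trans hI
    · rw [List.map_map]
      conv_rhs => rw [← List.map_id I.cols]
      refine List.map_congr_left fun v hv => ?_
      funext i
      simp only [Function.comp_apply, g, Fin.ofNat, id]
      refine Nat.mod_eq_of_lt ?_
      have h1 : v i ≤ wt v := Finset.single_le_sum (fun _ _ => Nat.zero_le _) (Finset.mem_univ i)
      have h2 : wt v ≤ I.weight := List.le_sum_of_mem (List.mem_map_of_mem hv)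
      have h3 : I.weight ≤ N := hI
      omega
  · intro I _ J _ h
    exact VecComp.ext h

theorem wt_total (I : VecComp l) : wt I.total = I.weight := by
  have : ∀ L : List (Fin l → ℕ), wt L.sum = (L.map wt).sum := by
    intro L
    induction L with
    | nil => simp [wt]
    | cons v t ih =>
      rw [List.sum_cons, List.map_cons, List.sum_cons, ← ih]
      simp [wt, Finset.sum_add_distrib]
  exact this _

theorem finite_total (n : Fin l → ℕ) : {I : VecComp l | I.total = n}.Finite :=
  (finite_weight_le (wt n)).subset fun I hI => by
    have h : I.total = n := hI
    change I.weight ≤ wt n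
    rw [← wt_total, h]

/-- `Comp(n)`, the finite set of vector compositions of `n`. -/
def compositions (n : Fin l → ℕ) : Finset (VecComp l) := (finite_total n).toFinset

/-- The exponent of the monomial `x_{j_1}^{i_1} ⋯ x_{j_m}^{i_m}`, where `I = (i_1, …, i_m)`. The
index `(i, j)` stands for the variable of color `i` with subscript `j`; subscripts start at `0`. -/
def expo (I : VecComp l) (j : Fin I.cols.length → ℕ) : (Fin l × ℕ) →₀ ℕ :=
  ∑ r, ∑ i, Finsupp.single (i, j r) (I.cols.get r i)

/-- The exponent of the monomial `x_1^{i_1} ⋯ x_m^{i_m}` in the first `m` subscripts. -/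
def stdExpo (I : VecComp l) : (Fin l × ℕ) →₀ ℕ := I.expo fun r => (r : ℕ)

theorem expo_apply (I : VecComp l) (j : Fin I.cols.length → ℕ) (i : Fin l) (s : ℕ) :
    I.expo j (i, s) = ∑ r, if j r = s then I.cols.get r i else 0 := by
  unfold expo
  rw [Finsupp.finsetSum_apply]
  refine Finset.sum_congr rfl fun r _ => ?_
  rw [Finsupp.finsetSum_apply, Finset.sum_eq_single i]
  · simp [Finsupp.single_apply]
  · intro b _ hb
    simp [hb]
  · simp

theorem expo_apply_self (I : VecComp l) {j : Fin I.cols.length → ℕ} (hj : Function.Injective j)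
    (i : Fin l) (r : Fin I.cols.length) : I.expo j (i, j r) = I.cols.get r i := by
  rw [expo_apply, Finset.sum_eq_single r]
  · simp
  · intro b _ hb
    rw [if_neg fun h => hb (hj h)]
  · simp

/-- The set of subscripts occurring in a monomial. -/
def subscripts (d : (Fin l × ℕ) →₀ ℕ) : Finset ℕ := d.support.image Prod.snd

theorem mem_subscripts {d : (Fin l × ℕ) →₀ ℕ} {s : ℕ} :
    s ∈ subscripts d ↔ ∃ i, d (i, s) ≠ 0 := by
  unfold subscripts
  simp

/-- The sequence of nonzero columns of a monomial, in increasing order of their subscripts. -/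
def compress (d : (Fin l × ℕ) →₀ ℕ) : VecComp l :=
  ⟨((subscripts d).sort).map fun s i => d (i, s), by
    intro v hv
    obtain ⟨s, hs, rfl⟩ := List.mem_map.1 hv
    obtain ⟨i, hi⟩ := mem_subscripts.1 ((Finset.mem_sort _).1 hs)
    exact fun h => hi (congrFun h i)⟩

theorem sort_eq_of {s : Finset ℕ} {L : List ℕ} (hL : L.Pairwise (· < ·))
    (h : ∀ x, x ∈ L ↔ x ∈ s) : s.sort = L := by
  refine List.Perm.eq_of_pairwise (le := (· ≤ ·)) (fun a b _ _ h1 h2 => le_antisymm h1 h2)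
    (Finset.pairwise_sort s (· ≤ ·)) (hL.imp le_of_lt) ?_
  refine (List.perm_ext_iff_of_nodup (Finset.sort_nodup s (· ≤ ·)) (hL.imp ne_of_lt)).2 fun x => ?_
  rw [h, Finset.mem_sort]

theorem compress_expo (I : VecComp l) {j : Fin I.cols.length → ℕ} (hj : StrictMono j) :
    compress (I.expo j) = I := by
  have hs : (subscripts (I.expo j)).sort = List.ofFn j := by
    refine sort_eq_of (List.pairwise_ofFn.2 fun a b h => hj h) fun x => ?_
    rw [List.mem_ofFn, mem_subscripts]
    constructor
    · rintro ⟨r, rfl⟩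
      have hne := I.ne_zero (I.cols.get r) (List.get_mem _ _)
      obtain ⟨i, hi⟩ := Function.ne_iff.1 hne
      exact ⟨i, by rw [expo_apply_self I hj.injective]; exact hi⟩
    · rintro ⟨i, hi⟩
      rw [expo_apply] at hi
      obtain ⟨r, _, hr⟩ := Finset.exists_ne_zero_of_sum_ne_zero hi
      refine ⟨r, ?_⟩
      by_contra h
      exact hr (if_neg h)
  apply VecComp.ext
  change ((subscripts (I.expo j)).sort).map _ = _
  rw [hs, List.map_ofFn]
  conv_rhs => rw [← List.ofFn_get I.cols]
  congr 1
  funext r i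
  exact expo_apply_self I hj.injective i r

theorem exists_expo_compress (d : (Fin l × ℕ) →₀ ℕ) :
    ∃ j : Fin (compress d).cols.length → ℕ, StrictMono j ∧ (compress d).expo j = d := by
  have hlen : (compress d).cols.length = (subscripts d).sort.length := by simp [compress]
  have hsm : (subscripts d).sort.Pairwise (· < ·) := (Finset.sortedLT_sort _).pairwise
  refine ⟨fun r => (subscripts d).sort.get (r.cast hlen), ?_, ?_⟩
  · intro a b hab
    exact List.pairwise_iff_get.1 hsm _ _ hab
  · ext ⟨i, s⟩
    rw [expo_apply]
    by_cases hs : s ∈ subscripts d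
    · obtain ⟨r, hr⟩ := List.get_of_mem ((Finset.mem_sort (· ≤ ·)).2 hs)
      rw [Finset.sum_eq_single (r.cast hlen.symm)]
      · have h1 : (subscripts d).sort.get ((r.cast hlen.symm).cast hlen) = s := hr
        rw [if_pos h1]
        simp only [compress, List.get_eq_getElem, List.getElem_map]
        rw [← hr]; rfl
      · intro b _ hb
        refine if_neg fun h => hb ?_
        have hnd : (subscripts d).sort.Nodup := Finset.sort_nodup _ _
        have := (List.nodup_iff_injective_get.1 hnd) (h.trans hr.symm)
        ext
        have h2 := congrArg Fin.val this
        simpa using h2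
      · simp
    · have h0 : d (i, s) = 0 := by
        by_contra h
        exact hs (mem_subscripts.2 ⟨i, h⟩)
      rw [h0]
      refine Finset.sum_eq_zero fun r _ => if_neg fun h => hs ?_
      rw [← h, ← Finset.mem_sort (· ≤ ·)]
      exact List.get_mem _ _

theorem strictMono_val {n : ℕ} : StrictMono fun r : Fin n => (r : ℕ) := fun _ _ h => h

theorem compress_stdExpo (I : VecComp l) : compress I.stdExpo = I :=
  compress_expo I strictMono_val

theorem degree_expo (I : VecComp l) (j : Fin I.cols.length → ℕ) :
    (I.expo j).degree = I.weight := by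
  unfold expo weight
  rw [map_sum]
  have : ∀ r, (∑ i, Finsupp.single (i, j r) (I.cols.get r i)).degree = wt (I.cols.get r) := by
    intro r
    rw [map_sum]
    simp [wt]
  simp_rw [this]
  conv_rhs => rw [← List.ofFn_get I.cols, List.map_ofFn, List.sum_ofFn]
  rfl

theorem weight_compress (d : (Fin l × ℕ) →₀ ℕ) : (compress d).weight = d.degree := by
  obtain ⟨j, -, h⟩ := exists_expo_compress d
  rw [← degree_expo _ j, h]

end VecComp

/-! ### Quasisymmetric functions of level `l` -/

open VecComp

/-- A formal power series in the variables `x_j^{(i)}` (`i` a color, `j` a subscript) is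
quasisymmetric of level `l` if it has finite degree and the coefficients of
`x_1^{i_1} ⋯ x_m^{i_m}` and `x_{j_1}^{i_1} ⋯ x_{j_m}^{i_m}` agree whenever `j_1 < ⋯ < j_m` and
`(i_1, …, i_m)` is a vector composition. -/
def IsQuasisymmetric {l : ℕ} (f : MvPowerSeries (Fin l × ℕ) ℚ) : Prop :=
  (∃ N : ℕ, ∀ d, MvPowerSeries.coeff d f ≠ 0 → d.degree ≤ N) ∧
  ∀ (I : VecComp l) (j : Fin I.cols.length → ℕ), StrictMono j →
    MvPowerSeries.coeff (I.expo j) f = MvPowerSeries.coeff I.stdExpo f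

namespace IsQuasisymmetric

variable {l : ℕ}

theorem coeff_eq {f : MvPowerSeries (Fin l × ℕ) ℚ} (hf : IsQuasisymmetric f)
    (d : (Fin l × ℕ) →₀ ℕ) :
    MvPowerSeries.coeff d f = MvPowerSeries.coeff (compress d).stdExpo f := by
  obtain ⟨j, hj, h⟩ := exists_expo_compress d
  conv_lhs => rw [← h]
  exact hf.2 _ j hj

theorem of_compress {f : MvPowerSeries (Fin l × ℕ) ℚ}
    (hN : ∃ N : ℕ, ∀ d, MvPowerSeries.coeff d f ≠ 0 → d.degree ≤ N)
    (h : ∀ d d', compress d = compress d' →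
      MvPowerSeries.coeff d f = MvPowerSeries.coeff d' f) : IsQuasisymmetric f :=
  ⟨hN, fun I j hj => h _ _ (by rw [compress_expo I hj, compress_stdExpo])⟩

/-- Renaming of subscripts along an increasing map. -/
def shift (σ : ℕ ↪o ℕ) : (Fin l × ℕ) ↪ (Fin l × ℕ) :=
  (Function.Embedding.refl _).prodMap σ.toEmbedding

theorem embDomain_shift_apply (σ : ℕ ↪o ℕ) (d : (Fin l × ℕ) →₀ ℕ) (i : Fin l) (s : ℕ) :
    Finsupp.embDomain (shift σ) d (i, σ s) = d (i, s) :=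
  Finsupp.embDomain_apply_self (shift σ) d (i, s)

theorem compress_embDomain (σ : ℕ ↪o ℕ) (d : (Fin l × ℕ) →₀ ℕ) :
    compress (Finsupp.embDomain (shift σ) d) = compress d := by
  have hs : (subscripts (Finsupp.embDomain (shift σ) d)).sort = ((subscripts d).sort).map σ := by
    refine sort_eq_of ?_ fun x => ?_
    · exact List.Pairwise.map _ (fun a b h => σ.strictMono h)
        (Finset.sortedLT_sort _).pairwise
    · simp only [List.mem_map, Finset.mem_sort, mem_subscripts]
      constructor
      · rintro ⟨s, ⟨i, hi⟩, rfl⟩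
        exact ⟨i, by rwa [embDomain_shift_apply]⟩
      · rintro ⟨i, hi⟩
        have hmem : (i, x) ∈ Set.range (shift (l := l) σ) := by
          by_contra h
          exact hi (Finsupp.embDomain_of_notMem_range _ _ _ h)
        obtain ⟨⟨i', s⟩, h⟩ := hmem
        have h1 : i' = i := congrArg Prod.fst h
        have h2 : σ s = x := congrArg Prod.snd h
        subst h1 h2
        rw [embDomain_shift_apply] at hi
        exact ⟨s, ⟨i', hi⟩, rfl⟩
  apply VecComp.ext
  change ((subscripts _).sort).map _ = ((subscripts d).sort).map _
  rw [hs, List.map_map]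
  refine List.map_congr_left fun s _ => ?_
  funext i
  exact embDomain_shift_apply σ d i s

theorem killCompl_eq {f : MvPowerSeries (Fin l × ℕ) ℚ} (hf : IsQuasisymmetric f)
    (σ : ℕ ↪o ℕ) : MvPowerSeries.killCompl (shift σ) f = f := by
  ext d
  rw [MvPowerSeries.coeff_killCompl, hf.coeff_eq, hf.coeff_eq d, compress_embDomain]

theorem exists_shift (I : VecComp l) {j : Fin I.cols.length → ℕ} (hj : StrictMono j) :
    ∃ σ : ℕ ↪o ℕ, Finsupp.embDomain (shift σ) I.stdExpo = I.expo j := by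
  let σf : ℕ → ℕ := fun n => if h : n < I.cols.length then j ⟨n, h⟩ else (∑ r, j r) + n + 1
  have hσ : StrictMono σf := by
    intro a b hab
    by_cases hb : b < I.cols.length
    · have ha : a < I.cols.length := hab.trans hb
      simp only [σf, dif_pos ha, dif_pos hb]
      exact hj hab
    · by_cases ha : a < I.cols.length
      · simp only [σf, dif_pos ha, dif_neg hb]
        have : j ⟨a, ha⟩ ≤ ∑ r, j r :=
          Finset.single_le_sum (fun _ _ => Nat.zero_le _) (Finset.mem_univ _)
        omega
      · simp only [σf, dif_neg ha, dif_neg hb]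
        omega
  refine ⟨OrderEmbedding.ofStrictMono σf hσ, ?_⟩
  unfold stdExpo expo
  rw [Finsupp.embDomain_eq_mapDomain, Finsupp.mapDomain_finsetSum]
  refine Finset.sum_congr rfl fun r _ => ?_
  rw [Finsupp.mapDomain_finsetSum]
  refine Finset.sum_congr rfl fun i _ => ?_
  rw [Finsupp.mapDomain_single]
  congr 1
  change (i, σf r) = (i, j r)
  simp [σf]

theorem of_killCompl {f : MvPowerSeries (Fin l × ℕ) ℚ}
    (hN : ∃ N : ℕ, ∀ d, MvPowerSeries.coeff d f ≠ 0 → d.degree ≤ N)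
    (h : ∀ σ : ℕ ↪o ℕ, MvPowerSeries.killCompl (shift σ) f = f) : IsQuasisymmetric f := by
  refine ⟨hN, fun I j hj => ?_⟩
  obtain ⟨σ, hσ⟩ := exists_shift I hj
  rw [← hσ, ← MvPowerSeries.coeff_killCompl, h σ]

theorem add {f g : MvPowerSeries (Fin l × ℕ) ℚ} (hf : IsQuasisymmetric f)
    (hg : IsQuasisymmetric g) : IsQuasisymmetric (f + g) := by
  obtain ⟨N, hN⟩ := hf.1
  obtain ⟨N', hN'⟩ := hg.1
  refine of_killCompl ⟨max N N', fun d hd => ?_⟩ fun σ => by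
    rw [map_add, hf.killCompl_eq, hg.killCompl_eq]
  by_cases h1 : MvPowerSeries.coeff d f = 0
  · exact (hN' d fun h2 => hd (by rw [map_add, h1, h2, add_zero])).trans (le_max_right _ _)
  · exact (hN d h1).trans (le_max_left _ _)

theorem mul {f g : MvPowerSeries (Fin l × ℕ) ℚ} (hf : IsQuasisymmetric f)
    (hg : IsQuasisymmetric g) : IsQuasisymmetric (f * g) := by
  obtain ⟨N, hN⟩ := hf.1
  obtain ⟨N', hN'⟩ := hg.1
  refine of_killCompl ⟨N + N', fun d hd => ?_⟩ fun σ => by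
    rw [map_mul, hf.killCompl_eq, hg.killCompl_eq]
  rw [MvPowerSeries.coeff_mul] at hd
  obtain ⟨p, hp, hpne⟩ := Finset.exists_ne_zero_of_sum_ne_zero hd
  rw [← Finset.HasAntidiagonal.mem_antidiagonal.1 hp, map_add]
  exact add_le_add (hN _ (left_ne_zero_of_mul hpne)) (hN' _ (right_ne_zero_of_mul hpne))

theorem algebraMap (r : ℚ) :
    IsQuasisymmetric (algebraMap ℚ (MvPowerSeries (Fin l × ℕ) ℚ) r) := by
  refine of_killCompl ⟨0, fun d hd => ?_⟩ fun σ => AlgHom.commutes _ r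
  rw [MvPowerSeries.algebraMap_apply, Algebra.algebraMap_self, RingHom.id_apply,
    MvPowerSeries.coeff_C] at hd
  by_cases h : d = 0
  · simp [h]
  · exact absurd (if_neg h) hd

end IsQuasisymmetric

/-- The algebra `QSym^{(l)}` of quasisymmetric functions of level `l`, over `ℚ`. -/
def QSym (l : ℕ) : Subalgebra ℚ (MvPowerSeries (Fin l × ℕ) ℚ) where
  carrier := {f | IsQuasisymmetric f}
  mul_mem' hf hg := IsQuasisymmetric.mul hf hg
  add_mem' hf hg := IsQuasisymmetric.add hf hg
  algebraMap_mem' r := IsQuasisymmetric.algebraMap r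

namespace QSym

variable {l : ℕ}

/-- The monomial quasisymmetric function
`M_I = ∑_{j_1 < ⋯ < j_m} x_{j_1}^{i_1} ⋯ x_{j_m}^{i_m}`. (As the columns of `I` are nonzero, a
monomial arises from at most one sequence `j`.) -/
def M (I : VecComp l) : QSym l :=
  ⟨fun d => if ∃ j : Fin I.cols.length → ℕ, StrictMono j ∧ I.expo j = d then 1 else 0, by
    have key : ∀ d, (∃ j : Fin I.cols.length → ℕ, StrictMono j ∧ I.expo j = d) ↔
        compress d = I := by
      intro d
      constructor
      · rintro ⟨j, hj, rfl⟩
        exact compress_expo I hj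
      · rintro rfl
        exact exists_expo_compress d
    refine IsQuasisymmetric.of_compress ⟨I.weight, fun d hd => ?_⟩ fun d d' h => ?_
    · have h1 : ∃ j : Fin I.cols.length → ℕ, StrictMono j ∧ I.expo j = d := by
        by_contra h
        exact hd (if_neg h)
      rw [← weight_compress, (key d).1 h1]
    · change (if _ then (1 : ℚ) else 0) = if _ then (1 : ℚ) else 0
      simp only [key, h]⟩

theorem coeff_M (I : VecComp l) (d : (Fin l × ℕ) →₀ ℕ) :
    MvPowerSeries.coeff d (M I : MvPowerSeries (Fin l × ℕ) ℚ) =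
      if compress d = I then 1 else 0 := by
  change (if ∃ j : Fin I.cols.length → ℕ, StrictMono j ∧ I.expo j = d then (1 : ℚ) else 0) = _
  refine if_congr ⟨?_, ?_⟩ rfl rfl
  · rintro ⟨j, hj, rfl⟩
    exact compress_expo I hj
  · rintro rfl
    exact exists_expo_compress d

/-- The coordinates of a quasisymmetric function in the monomial basis. -/
def coords : QSym l ≃ₗ[ℚ] (VecComp l →₀ ℚ) where
  toFun f := Finsupp.ofSupportFinite
    (fun I => MvPowerSeries.coeff I.stdExpo (f : MvPowerSeries (Fin l × ℕ) ℚ)) (by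
      obtain ⟨N, hN⟩ := f.2.1
      refine (finite_weight_le N).subset fun I hI => ?_
      have := hN _ hI
      rwa [stdExpo, degree_expo] at this)
  invFun c := ⟨fun d => c (compress d), by
    refine IsQuasisymmetric.of_compress ⟨c.support.sup weight, fun d hd => ?_⟩ fun d d' h => ?_
    · rw [← weight_compress]
      exact Finset.le_sup (f := weight) (Finsupp.mem_support_iff.2 hd)
    · change c (compress d) = c (compress d')
      rw [h]⟩
  map_add' f g := by
    ext I
    exact map_add (MvPowerSeries.coeff I.stdExpo) (f : MvPowerSeries (Fin l × ℕ) ℚ) g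
  map_smul' r f := by
    ext I
    exact map_smul (MvPowerSeries.coeff I.stdExpo) r (f : MvPowerSeries (Fin l × ℕ) ℚ)
  left_inv f := by
    apply Subtype.ext
    ext d
    exact (f.2.coeff_eq d).symm
  right_inv c := by
    ext I
    change c (compress I.stdExpo) = c I
    rw [compress_stdExpo]

/-- The monomial basis. -/
def basis (l : ℕ) : Module.Basis (VecComp l) ℚ (QSym l) := Module.Basis.ofRepr coords

theorem basis_apply (I : VecComp l) : basis l I = M I := by
  apply Subtype.ext
  ext d
  rw [coeff_M]
  change (Finsupp.single I (1 : ℚ)) (compress d) = _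
  rw [Finsupp.single_apply]
  exact if_congr eq_comm rfl rfl

/-- The coproduct `Δ(M_I) = ∑_{I = JK} M_J ⊗ M_K`, and the counit, which is the projection onto
the component of degree `0`. -/
instance : CoalgebraStruct ℚ (QSym l) where
  comul := (basis l).constr ℚ fun I =>
    ∑ k ∈ Finset.range (I.len + 1), M (I.take k) ⊗ₜ[ℚ] M (I.drop k)
  counit := (basis l).constr ℚ fun I => if I = empty then 1 else 0

theorem comul_M (I : VecComp l) : CoalgebraStruct.comul (R := ℚ) (M I) =
    ∑ k ∈ Finset.range (I.len + 1), M (I.take k) ⊗ₜ[ℚ] M (I.drop k) := by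
  rw [← basis_apply]
  exact (basis l).constr_basis ℚ _ I

theorem counit_M (I : VecComp l) :
    CoalgebraStruct.counit (R := ℚ) (M I) = if I = empty then (1 : ℚ) else 0 := by
  rw [← basis_apply]
  exact (basis l).constr_basis ℚ _ I

theorem eq_empty_iff (I : VecComp l) : I = empty ↔ I.len = 0 :=
  ⟨fun h => by rw [h]; rfl, fun h => VecComp.ext (List.length_eq_zero_iff.1 h)⟩

theorem len_take (I : VecComp l) (k : ℕ) : (I.take k).len = min k I.len := List.length_take
theorem len_drop (I : VecComp l) (k : ℕ) : (I.drop k).len = I.len - k := List.length_drop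
theorem take_len (I : VecComp l) : I.take I.len = I := VecComp.ext List.take_length
theorem drop_zero (I : VecComp l) : I.drop 0 = I := VecComp.ext List.drop_zero

theorem basis_ext {V : Type*} [AddCommMonoid V] [Module ℚ V] {f g : QSym l →ₗ[ℚ] V}
    (h : ∀ I, f (M I) = g (M I)) : f = g :=
  (basis l).ext fun I => by rw [basis_apply, h]

instance : Coalgebra ℚ (QSym l) where
  coassoc := by
    refine basis_ext fun I => ?_
    simp only [LinearMap.comp_apply, comul_M, map_sum, LinearMap.rTensor_tmul,
      LinearMap.lTensor_tmul, TensorProduct.sum_tmul, TensorProduct.tmul_sum,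
      LinearEquiv.coe_coe, TensorProduct.assoc_tmul]
    rw [Finset.sum_sigma', Finset.sum_sigma']
    refine Finset.sum_bij' (fun p _ => ⟨p.2, p.1 - p.2⟩) (fun p _ => ⟨p.1 + p.2, p.1⟩) ?_ ?_ ?_ ?_ ?_
    · rintro ⟨a, b⟩ h
      simp only [Finset.mem_sigma, Finset.mem_range, len_take, len_drop] at h ⊢
      omega
    · rintro ⟨a, b⟩ h
      simp only [Finset.mem_sigma, Finset.mem_range, len_take, len_drop] at h ⊢
      omega
    · rintro ⟨a, b⟩ h
      simp only [Finset.mem_sigma, Finset.mem_range, len_take] at h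
      have : b + (a - b) = a := by omega
      simp [this]
    · rintro ⟨a, b⟩ h
      simp
    · rintro ⟨a, b⟩ h
      simp only [Finset.mem_sigma, Finset.mem_range, len_take] at h
      have h1 : (I.take a).take b = I.take b := VecComp.ext (by
        simp only [VecComp.take, List.take_take]
        congr 1; omega)
      have h2 : (I.take a).drop b = (I.drop b).take (a - b) := VecComp.ext (by
        simp only [VecComp.take, VecComp.drop, List.drop_take])
      have h3 : (I.drop b).drop (a - b) = I.drop a := VecComp.ext (by
        simp only [VecComp.drop, List.drop_drop]
        congr 1; omega)
      simp only [h1, h2, h3]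
  rTensor_counit_comp_comul := by
    refine basis_ext fun I => ?_
    simp only [LinearMap.comp_apply, comul_M, map_sum, LinearMap.rTensor_tmul, counit_M]
    rw [Finset.sum_eq_single 0]
    · rw [if_pos ((eq_empty_iff _).2 (by rw [len_take]; simp)), drop_zero]
      rfl
    · intro k hk hk0
      rw [Finset.mem_range] at hk
      rw [if_neg, TensorProduct.zero_tmul]
      rw [eq_empty_iff, len_take]
      omega
    · simp
  lTensor_counit_comp_comul := by
    refine basis_ext fun I => ?_
    simp only [LinearMap.comp_apply, comul_M, map_sum, LinearMap.lTensor_tmul, counit_M]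
    rw [Finset.sum_eq_single I.len]
    · rw [if_pos ((eq_empty_iff _).2 (by rw [len_drop]; simp)), take_len]
      rfl
    · intro k hk hk0
      rw [Finset.mem_range] at hk
      rw [if_neg, TensorProduct.tmul_zero]
      rw [eq_empty_iff, len_drop]
      omega
    · simp

/-- The multidegree of a monomial. -/
def mdeg (d : (Fin l × ℕ) →₀ ℕ) : Fin l → ℕ := d.sum fun p a => Pi.single p.1 a

/-- The component `QSym^{(l)}_n` of quasisymmetric functions homogeneous of multidegree `n`. -/
def component (n : Fin l → ℕ) : Submodule ℚ (QSym l) where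
  carrier := {f | ∀ d, MvPowerSeries.coeff d (f : MvPowerSeries (Fin l × ℕ) ℚ) ≠ 0 → mdeg d = n}
  add_mem' {f g} hf hg d hd := by
    by_cases h : MvPowerSeries.coeff d (f : MvPowerSeries (Fin l × ℕ) ℚ) = 0
    · refine hg d fun h' => hd ?_
      change MvPowerSeries.coeff d (f + g : MvPowerSeries (Fin l × ℕ) ℚ) = 0
      rw [map_add, h, h', add_zero]
    · exact hf d h
  zero_mem' d hd := absurd rfl hd
  smul_mem' r f hf d hd := hf d fun h => hd (by
    change MvPowerSeries.coeff d (r • (f : MvPowerSeries (Fin l × ℕ) ℚ)) = 0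
    rw [map_smul, h, smul_zero])

/-- The quasi-ribbon function `F_I = ∑_{I ≼ J} M_J`. -/
def F (I : VecComp l) : QSym l := ∑ J ∈ compositions I.total with I.ColorRefines J, M J

/-- `η_I = ∑_{J ⊴ I} 2^{ℓ(J)} M_J`. -/
def eta (I : VecComp l) : QSym l :=
  ∑ J ∈ compositions I.total with J.Refines I, (2 : ℚ) ^ J.len • M J

/-- The inclusion of the variables with the first subscript. -/
def firstVars (l : ℕ) : Fin l ↪ Fin l × ℕ := ⟨fun i => (i, 0), fun _ _ h => congrArg Prod.fst h⟩

theorem zeta_support_finite (f : QSym l) : (Function.support fun n : Fin l →₀ ℕ =>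
    MvPowerSeries.coeff n (MvPowerSeries.killCompl (firstVars l)
      (f : MvPowerSeries (Fin l × ℕ) ℚ))).Finite := by
  obtain ⟨N, hN⟩ := f.2.1
  refine (finite_weight_le (l := l) N).preimage (f := fun n : Fin l →₀ ℕ =>
    compress (Finsupp.embDomain (firstVars l) n)) ?_ |>.subset fun n hn => ?_
  · intro n _ n' _ h
    have hcol : ∀ n : Fin l →₀ ℕ,
        (compress (Finsupp.embDomain (firstVars l) n)).total = ⇑n := by
      intro n
      have happ : ∀ i, Finsupp.embDomain (firstVars l) n (i, 0) = n i := fun i =>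
        Finsupp.embDomain_apply_self (firstVars l) n i
      have hsub : ∀ s ∈ subscripts (Finsupp.embDomain (firstVars l) n), s = 0 := by
        intro s hs
        obtain ⟨i, hi⟩ := mem_subscripts.1 hs
        by_contra hne
        refine hi (Finsupp.embDomain_of_notMem_range _ _ _ ?_)
        rintro ⟨i', h'⟩
        exact hne (congrArg Prod.snd h').symm
      by_cases h0 : (0 : ℕ) ∈ subscripts (Finsupp.embDomain (firstVars l) n)
      · have : subscripts (Finsupp.embDomain (firstVars l) n) = {0} := by
          ext s
          rw [Finset.mem_singleton]
          exact ⟨hsub s, fun h => h ▸ h0⟩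
        change (((subscripts (Finsupp.embDomain (firstVars l) n)).sort).map
          fun s i => Finsupp.embDomain (firstVars l) n (i, s)).sum = _
        rw [this]
        funext i
        simp [happ]
      · have : subscripts (Finsupp.embDomain (firstVars l) n) = ∅ :=
          Finset.eq_empty_of_forall_notMem fun s hs => h0 (hsub s hs ▸ hs)
        change (((subscripts (Finsupp.embDomain (firstVars l) n)).sort).map
          fun s i => Finsupp.embDomain (firstVars l) n (i, s)).sum = _
        rw [this]
        funext i
        have hz : n i = 0 := by
          by_contra hne
          exact h0 (mem_subscripts.2 ⟨i, by rw [happ]; exact hne⟩)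
        simp [hz]
    apply DFunLike.coe_injective
    rw [← hcol n, ← hcol n']
    exact congrArg total h
  · have h1 : MvPowerSeries.coeff n (MvPowerSeries.killCompl (firstVars l)
      (f : MvPowerSeries (Fin l × ℕ) ℚ)) ≠ 0 := hn
    rw [MvPowerSeries.coeff_killCompl] at h1
    change (compress _).weight ≤ N
    rw [weight_compress]
    exact hN _ h1

/-- The universal character `ζ_Q`: set all variables with the first subscript equal to `1` and all
other variables equal to `0`. -/
def zeta (l : ℕ) : QSym l →ₗ[ℚ] ℚ where
  toFun f := ∑ᶠ n : Fin l →₀ ℕ, MvPowerSeries.coeff n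
    (MvPowerSeries.killCompl (firstVars l) (f : MvPowerSeries (Fin l × ℕ) ℚ))
  map_add' f g := by
    rw [← finsum_add_distrib (zeta_support_finite f) (zeta_support_finite g)]
    refine finsum_congr fun n => ?_
    rw [← map_add, ← map_add]; rfl
  map_smul' r f := by
    rw [RingHom.id_apply, smul_finsum]
    refine finsum_congr fun n => ?_
    rw [← map_smul, ← map_smul]; rfl

/-- The functional `ζ_Q^k` which on `QSym^{(l)}_n` is `(-1)^{|n|} ζ_Q` if `n ≤ k`, and `ζ_Q`
otherwise. It is given on the basis `M_I`, which is homogeneous of multidegree `ΣI`. -/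
def zetaK (k : Fin l → ℕ∞) : QSym l →ₗ[ℚ] ℚ :=
  (basis l).constr ℚ fun I =>
    if ∀ i, (I.total i : ℕ∞) ≤ k i then (-1) ^ I.weight * zeta l (M I) else zeta l (M I)

/-! The antipode -/

/-- A left convolution inverse of the identity. -/
def leftInv (I : VecComp l) : QSym l :=
  if I = empty then M empty
  else -∑ k : Fin I.len, leftInv (I.take k) * M (I.drop k)
termination_by I.len
decreasing_by
  rw [len_take]
  omega

/-- A right convolution inverse of the identity. -/
def rightInv (I : VecComp l) : QSym l :=
  if I = empty then M empty
  else -∑ k : Fin I.len, M (I.take (k + 1)) * rightInv (I.drop (k + 1))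
termination_by I.len
decreasing_by
  rw [len_drop]
  have := k.2
  omega

theorem M_empty : M (empty : VecComp l) = 1 := by
  apply Subtype.ext
  ext d
  rw [coeff_M]
  change _ = MvPowerSeries.coeff d (1 : MvPowerSeries (Fin l × ℕ) ℚ)
  rw [MvPowerSeries.coeff_one]
  refine if_congr ⟨fun h => ?_, fun h => ?_⟩ rfl rfl
  · rw [← Finsupp.degree_eq_zero_iff, ← weight_compress, h]
    rfl
  · rw [h]
    apply VecComp.ext
    simp [compress, subscripts, empty]

open WithConv in
theorem isUnit_id : IsUnit (toConv (LinearMap.id : QSym l →ₗ[ℚ] QSym l)) := by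
  have hone : ∀ I : VecComp l, (1 : WithConv (QSym l →ₗ[ℚ] QSym l)) (M I) =
      if I = empty then 1 else 0 := by
    intro I
    rw [LinearMap.convOne_apply, counit_M]
    split_ifs <;> simp
  set S := toConv ((basis l).constr ℚ (leftInv (l := l))) with hS
  set T := toConv ((basis l).constr ℚ (rightInv (l := l))) with hT
  have hSM : ∀ I, S.ofConv (M I) = leftInv I := fun I => by
    rw [← basis_apply]
    exact (basis l).constr_basis ℚ _ I
  have hTM : ∀ I, T.ofConv (M I) = rightInv I := fun I => by
    rw [← basis_apply]
    exact (basis l).constr_basis ℚ _ I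
  have h1 : S * toConv (LinearMap.id : QSym l →ₗ[ℚ] QSym l) = 1 := by
    apply ofConv_injective
    refine basis_ext fun I => ?_
    refine Eq.trans ?_ (hone I).symm
    change (S * toConv (LinearMap.id : QSym l →ₗ[ℚ] QSym l)) (M I) = _
    rw [LinearMap.convMul_apply, comul_M]
    simp only [map_sum, TensorProduct.map_tmul, LinearMap.mul'_apply, LinearMap.id_apply, hSM]
    by_cases h : I = empty
    · subst h
      rw [if_pos rfl]
      have hl : (empty : VecComp l).len = 0 := rfl
      have ht : (empty : VecComp l).take 0 = empty := VecComp.ext rfl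
      rw [hl, Finset.sum_range_one, ht, drop_zero, leftInv, if_pos rfl, M_empty, one_mul]
    · have hd : I.drop I.len = empty := (eq_empty_iff _).2 (by rw [len_drop]; simp)
      rw [if_neg h, Finset.sum_range_succ, take_len, hd, M_empty, mul_one]
      conv_lhs => rw [leftInv, if_neg h]
      rw [Finset.sum_range, add_neg_cancel]
  have h2 : toConv (LinearMap.id : QSym l →ₗ[ℚ] QSym l) * T = 1 := by
    apply ofConv_injective
    refine basis_ext fun I => ?_
    refine Eq.trans ?_ (hone I).symm
    change (toConv (LinearMap.id : QSym l →ₗ[ℚ] QSym l) * T) (M I) = _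
    rw [LinearMap.convMul_apply, comul_M]
    simp only [map_sum, TensorProduct.map_tmul, LinearMap.mul'_apply, LinearMap.id_apply, hTM]
    have ht : I.take 0 = empty := VecComp.ext rfl
    by_cases h : I = empty
    · subst h
      rw [if_pos rfl]
      have hl : (empty : VecComp l).len = 0 := rfl
      rw [hl, Finset.sum_range_one, ht, drop_zero, rightInv, if_pos rfl, M_empty, one_mul]
    · rw [if_neg h, Finset.sum_range_succ', ht, drop_zero, M_empty, one_mul]
      conv_lhs => rw [rightInv, if_neg h]
      rw [Finset.sum_range, add_neg_cancel]
  exact ⟨⟨_, S, by rw [left_inv_eq_right_inv h1 h2, h2], h1⟩, rfl⟩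

/-- The antipode: the inverse of the identity for the convolution product on
`QSym l →ₗ[ℚ] QSym l`. -/
def antipode (l : ℕ) : QSym l →ₗ[ℚ] QSym l :=
  (↑(isUnit_id (l := l)).unit⁻¹ : WithConv (QSym l →ₗ[ℚ] QSym l)).ofConv

/-- The functional `ν_Q^k = (ζ_Q^k ∘ S) ζ_Q`, a convolution product. -/
def nu (k : Fin l → ℕ∞) : QSym l →ₗ[ℚ] ℚ :=
  (WithConv.toConv (zetaK k ∘ₗ antipode l) * WithConv.toConv (zeta l)).ofConv

/-- `Θ` is the descents-to-peaks map `Θ^k`: a morphism of multigraded coalgebras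
`QSym^{(l)} → QSym^{(l)}` such that `ζ_Q ∘ Θ = ν_Q^k`. -/
def IsDescentsToPeaks (k : Fin l → ℕ∞) (Θ : QSym l →ₗc[ℚ] QSym l) : Prop :=
  (∀ n, ∀ f ∈ component n, Θ f ∈ component n) ∧ zeta l ∘ₗ Θ.toLinearMap = nu k

end QSym

end

open scoped Classical TensorProduct

noncomputable section

/-! Write `ξ_n` for the part of a functional `ξ` in multidegree `n` (`gradedPart`). Since `ζ(M_I)`
is `1` for length at most one and `0` otherwise, the coordinate functional of `M_J` is the
convolution product `ζ_{j_1} * ⋯ * ζ_{j_m}` over the columns of `J` (`gradedProd_eq_coord`). A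
morphism `Θ` of graded coalgebras turns it into `ν_{j_1} * ⋯ * ν_{j_m}`, where `ν = ζ ∘ Θ`
(`gradedProd_comp`). So `Θ` is determined by `ν` (`eq_liftHom`). Conversely, these products define a
linear map `lift ν`, which is a coalgebra morphism because the coordinates of `JK` are the
convolution of those of `J` and `K`; it satisfies `ζ ∘ lift ν = ν` once `ν(1) = 1`
(`zeta_comp_lift`).

For the formulas, both `M` and `F` are viewed as families indexed by words with deconcatenation as
coproduct. If `ν` takes the value `± 2` on "good" nonempty words and `0` on the other nonempty ones,
then the coefficient of `M_J` is `± 2^{ℓ(J)}` when the word factors into good words with contents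
the columns of `J`, and `0` otherwise: such a factorization is unique (`gradedProd_family`).

The functional `ν = χ * ζ` is accessible because `ζ` and its signed version are algebra morphisms,
evaluations at `1` and `-1`, so that `χ` is the convolution inverse of the latter
(`antipodeChar_mul`).

For `M_I` the letters are the columns, and a word is good when its last column has odd weight
(`nu_M`); factorizations into good words are groupings of the columns of `odd(I)`
(`exists_odd_blocks`).

For `F_I` the word is the coloring word with a descent flag at the end of each column
(`F_eq_ribbon`). There `χ` detects words with all inner flags set, `ζ` those with none, and `ν` is
`2` on words whose inner flags are set up to some point and unset afterwards, that is, without peak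
(`nu_ribbon`). A factorization has peak-free blocks exactly when each peak `s` of the whole word is
broken by a cut at `s` or at `s - 1` (`noPeak_blocks_iff`), which is the condition `Peak(I) ⊆ D(J) ∪
(D(J) + 1)`. -/

namespace VecComp

variable {l : ℕ}

/-- Concatenation of vector compositions. -/
def append (I J : VecComp l) : VecComp l :=
  ⟨I.cols ++ J.cols, fun v hv => (List.mem_append.1 hv).elim (I.ne_zero v) (J.ne_zero v)⟩

theorem mem_compositions {n : Fin l → ℕ} {I : VecComp l} : I ∈ compositions n ↔ I.total = n :=
  (finite_total n).mem_toFinset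

theorem total_eq_zero {I : VecComp l} : I.total = 0 ↔ I = empty := by
  constructor
  · intro h
    have h1 : I.weight = 0 := by rw [← wt_total, h]; simp [wt]
    have h2 := I.len_le_weight
    exact (QSym.eq_empty_iff I).2 (by omega)
  · rintro rfl
    rfl

end VecComp

/-! ### Coordinates as convolution products of graded functionals -/

namespace QSym

open VecComp WithConv

variable {l : ℕ}

theorem convMul_M (f g : WithConv (QSym l →ₗ[ℚ] ℚ)) (I : VecComp l) :
    (f * g) (M I) = ∑ k ∈ Finset.range (I.len + 1), f (M (I.take k)) * g (M (I.drop k)) := by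
  rw [LinearMap.convMul_apply, comul_M]
  simp only [map_sum, TensorProduct.map_tmul, LinearMap.mul'_apply]

theorem convOne_M (I : VecComp l) :
    (1 : WithConv (QSym l →ₗ[ℚ] ℚ)) (M I) = if I = empty then 1 else 0 := by
  rw [LinearMap.convOne_apply, counit_M]
  rfl

theorem conv_ext {f g : WithConv (QSym l →ₗ[ℚ] ℚ)} (h : ∀ I, f (M I) = g (M I)) : f = g :=
  ofConv_injective (basis_ext h)

/-- The functional that agrees with `ξ` in multidegree `n` and vanishes in the others. -/
def gradedPart (ξ : QSym l →ₗ[ℚ] ℚ) (n : Fin l → ℕ) : WithConv (QSym l →ₗ[ℚ] ℚ) :=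
  toConv ((basis l).constr ℚ fun I => if I.total = n then ξ (M I) else (0 : ℚ))

theorem gradedPart_M (ξ : QSym l →ₗ[ℚ] ℚ) (n : Fin l → ℕ) (I : VecComp l) :
    gradedPart ξ n (M I) = if I.total = n then ξ (M I) else 0 := by
  have h := (basis l).constr_basis ℚ (fun I => if I.total = n then ξ (M I) else (0 : ℚ)) I
  rwa [basis_apply] at h

/-- The convolution product of the graded parts of `ξ` in a list of multidegrees. -/
def gradedProd (ξ : QSym l →ₗ[ℚ] ℚ) (L : List (Fin l → ℕ)) : WithConv (QSym l →ₗ[ℚ] ℚ) :=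
  (L.map (gradedPart ξ)).prod

theorem gradedProd_nil (ξ : QSym l →ₗ[ℚ] ℚ) : gradedProd ξ [] = 1 := rfl

theorem gradedProd_cons (ξ : QSym l →ₗ[ℚ] ℚ) (v : Fin l → ℕ) (L : List (Fin l → ℕ)) :
    gradedProd ξ (v :: L) = gradedPart ξ v * gradedProd ξ L := List.prod_cons

theorem gradedProd_append (ξ : QSym l →ₗ[ℚ] ℚ) (L L' : List (Fin l → ℕ)) :
    gradedProd ξ (L ++ L') = gradedProd ξ L * gradedProd ξ L' := by
  rw [gradedProd, List.map_append, List.prod_append]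
  rfl

theorem total_take_add_total_drop (I : VecComp l) (k : ℕ) :
    (I.take k).total + (I.drop k).total = I.total := by
  change (I.cols.take k).sum + (I.cols.drop k).sum = I.cols.sum
  rw [← List.sum_append, List.take_append_drop]

/-- Multidegrees add under deconcatenation, so a product of homogeneous functionals is homogeneous.
-/
theorem gradedProd_M_of_ne (ξ : QSym l →ₗ[ℚ] ℚ) (L : List (Fin l → ℕ)) :
    ∀ I : VecComp l, I.total ≠ L.sum → gradedProd ξ L (M I) = 0 := by
  induction L with
  | nil =>
    intro I h
    rw [gradedProd_nil, convOne_M, if_neg fun h' => h (total_eq_zero.2 h')]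
  | cons v L ih =>
    intro I h
    rw [gradedProd_cons, convMul_M]
    refine Finset.sum_eq_zero fun k _ => ?_
    rw [gradedPart_M]
    split_ifs with hv
    · rw [ih, mul_zero]
      intro h'
      apply h
      rw [← total_take_add_total_drop I k, hv, h', List.sum_cons]
    · rw [zero_mul]

theorem coord_M (I J : VecComp l) : (basis l).coord J (M I) = if I = J then 1 else 0 := by
  rw [← basis_apply, Module.Basis.coord_apply, Module.Basis.repr_self, Finsupp.single_apply]

/-- Each factor `ξ_v` with `v ≠ 0` accepts only a single column, equal to `v`. The only surviving
way of cutting `I` is thus after every column, and it forces the columns of `I` to be those of `J`.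
-/
theorem gradedProd_eq_coord {ξ : QSym l →ₗ[ℚ] ℚ}
    (hξ : ∀ I, ξ (M I) = if I.len ≤ 1 then 1 else 0) (J : VecComp l) :
    (gradedProd ξ J.cols).ofConv = (basis l).coord J := by
  suffices H : ∀ L : List (Fin l → ℕ), (∀ v ∈ L, v ≠ 0) → ∀ I : VecComp l,
      gradedProd ξ L (M I) = if I.cols = L then 1 else 0 by
    refine basis_ext fun I => ?_
    rw [coord_M]
    refine (H J.cols J.ne_zero I).trans (if_congr ⟨fun h => VecComp.ext h, fun h => h ▸ rfl⟩ rfl rfl)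
  intro L
  induction L with
  | nil =>
    intro _ I
    rw [gradedProd_nil, convOne_M]
    exact if_congr ⟨fun h => h ▸ rfl, fun h => VecComp.ext h⟩ rfl rfl
  | cons v L ih =>
    intro hL I
    rw [gradedProd_cons, convMul_M]
    have hv : v ≠ 0 := hL v (by simp)
    have ih' := ih fun w hw => hL w (by simp [hw])
    have hzero : ∀ k, k ≠ 1 → k ≤ I.len →
        gradedPart ξ v (M (I.take k)) * gradedProd ξ L (M (I.drop k)) = 0 := by
      intro k hk hk'
      rw [gradedPart_M, hξ, len_take]
      split_ifs with h1 h2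
      -- An empty first piece has multidegree `0`, which is excluded because the columns of `J` are
      -- nonzero.
      · have : k = 0 := by omega
        subst this
        exact absurd h1.symm hv
      · rw [zero_mul]
      · rw [zero_mul]
    by_cases hI : I.len = 0
    · have h0 : I.cols = [] := List.length_eq_zero_iff.1 hI
      rw [h0, if_neg (by simp)]
      refine Finset.sum_eq_zero fun k hk => hzero k ?_ ?_
      · rw [Finset.mem_range] at hk; omega
      · rw [Finset.mem_range] at hk; omega
    · rw [Finset.sum_eq_single 1]
      · obtain ⟨u, t, hut⟩ := List.exists_cons_of_ne_nil (l := I.cols)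
          (fun h => hI (List.length_eq_zero_iff.2 h))
        have h1 : (I.take 1).total = u := by
          change (I.cols.take 1).sum = u
          rw [hut]; simp
        have h2 : (I.drop 1).cols = t := by
          change I.cols.drop 1 = t
          rw [hut]; rfl
        rw [gradedPart_M, ih', h1, h2, hξ, if_pos ((len_take I 1).trans_le (min_le_left _ _)), hut,
          ite_mul, one_mul, zero_mul, ← ite_and]
        exact if_congr (by rw [List.cons.injEq]) rfl rfl
      · intro k hk hk1
        rw [Finset.mem_range] at hk
        exact hzero k hk1 (by omega)
      · intro h
        rw [Finset.mem_range] at h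
        omega

theorem coeff_eq_coord (f : QSym l) (d : (Fin l × ℕ) →₀ ℕ) :
    MvPowerSeries.coeff d (f : MvPowerSeries (Fin l × ℕ) ℚ) = (basis l).coord (compress d) f :=
  f.2.coeff_eq d

theorem mdeg_add (d d' : (Fin l × ℕ) →₀ ℕ) : mdeg (d + d') = mdeg d + mdeg d' :=
  Finsupp.sum_add_index' (by simp) (by simp [Pi.single_add])

theorem mdeg_eq (d : (Fin l × ℕ) →₀ ℕ) : mdeg d = (compress d).total := by
  obtain ⟨j, -, h⟩ := exists_expo_compress d
  conv_lhs => rw [← h]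
  let φ : ((Fin l × ℕ) →₀ ℕ) →+ (Fin l → ℕ) := 
    { toFun := mdeg, map_zero' := Finsupp.sum_zero_index, map_add' := mdeg_add }
  change φ (expo _ j) = _
  unfold expo
  rw [map_sum]
  simp_rw [map_sum]
  have hs : ∀ (i : Fin l) (s n : ℕ), φ (Finsupp.single (i, s) n) = Pi.single i n := by
    intro i s n
    change mdeg _ = _
    unfold mdeg
    rw [Finsupp.sum_single_index (by simp)]
  simp_rw [hs, Finset.univ_sum_single]
  unfold total
  conv_rhs => rw [← List.ofFn_get (compress d).cols, List.sum_ofFn]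

/-- Replaces monomials by basis elements, which are homogeneous; from here on gradings are handled
through coordinates only. -/
theorem mem_component {n : Fin l → ℕ} {f : QSym l} :
    f ∈ component n ↔ ∀ J : VecComp l, (basis l).coord J f ≠ 0 → J.total = n := by
  change (∀ d, _) ↔ _
  simp_rw [coeff_eq_coord, mdeg_eq]
  refine ⟨fun h J hJ => ?_, fun h d => h _⟩
  have := h J.stdExpo
  rw [compress_stdExpo] at this
  exact this hJ

theorem M_mem_component (I : VecComp l) : M I ∈ component I.total := by
  rw [mem_component]
  intro J h
  rw [coord_M] at h
  by_contra h'
  exact h (if_neg fun h'' => h' (congrArg total h''.symm))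

theorem apply_eq_sum {V : Type*} [AddCommGroup V] [Module ℚ V] (φ : QSym l →ₗ[ℚ] V) (f : QSym l) :
    φ f = ((basis l).repr f).sum fun J c => c • φ (M J) := by
  conv_lhs => rw [← (basis l).linearCombination_repr f, Finsupp.linearCombination_apply, Finsupp.sum,
    map_sum]
  simp only [map_smul, basis_apply]
  rfl

theorem gradedPart_of_mem {n m : Fin l → ℕ} {f : QSym l} (hf : f ∈ component m)
    (ξ : QSym l →ₗ[ℚ] ℚ) : gradedPart ξ n f = if m = n then ξ f else 0 := by
  have h := apply_eq_sum (gradedPart ξ n).ofConv f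
  refine h.trans ?_
  rw [apply_eq_sum ξ f]
  have : ∀ J ∈ ((basis l).repr f).support, (gradedPart ξ n).ofConv (M J) =
      if m = n then ξ (M J) else 0 := by
    intro J hJ
    have h1 := mem_component.1 hf J (Finsupp.mem_support_iff.1 hJ)
    rw [← h1]
    exact gradedPart_M ξ n J
  rw [Finsupp.sum, Finset.sum_congr rfl fun J hJ => by rw [this J hJ]]
  split_ifs
  · rfl
  · simp

/-! ### Graded coalgebra morphisms and the functionals they lift -/

/-- A graded coalgebra morphism turns graded products of `ξ` into those of `ξ ∘ Θ`. -/
theorem gradedProd_comp {Θ : QSym l →ₗc[ℚ] QSym l} (hΘ : ∀ n, ∀ f ∈ component n, Θ f ∈ component n)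
    (ξ : QSym l →ₗ[ℚ] ℚ) (L : List (Fin l → ℕ)) :
    (gradedProd ξ L).ofConv ∘ₗ Θ.toLinearMap =
      (gradedProd (ξ ∘ₗ Θ.toLinearMap) L).ofConv := by
  induction L with
  | nil =>
    refine basis_ext fun I => ?_
    change (algebraMap ℚ ℚ) (CoalgebraStruct.counit (R := ℚ) (Θ (M I))) =
      (algebraMap ℚ ℚ) (CoalgebraStruct.counit (R := ℚ) (M I))
    rw [CoalgHomClass.counit_comp_apply]
  | cons v L ih =>
    rw [gradedProd_cons, LinearMap.convMul_comp_coalgHom_distrib, ih, gradedProd_cons]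
    congr 2
    refine conv_ext fun I => ?_
    rw [gradedPart_M]
    exact gradedPart_of_mem (hΘ _ _ (M_mem_component I)) ξ

theorem coord_ext {f g : QSym l} (h : ∀ J, (basis l).coord J f = (basis l).coord J g) : f = g :=
  (basis l).ext_elem h

/-- The linear map whose coefficients are the graded convolution products of `ν`. -/
def lift (ν : QSym l →ₗ[ℚ] ℚ) : QSym l →ₗ[ℚ] QSym l :=
  (basis l).constr ℚ fun I => ∑ J ∈ compositions I.total, gradedProd ν J.cols (M I) • M J

/-- Truncating the sum in `lift` to compositions of `I.total` loses nothing, by homogeneity of the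
products. -/
theorem coord_lift (ν : QSym l →ₗ[ℚ] ℚ) (J : VecComp l) :
    (basis l).coord J ∘ₗ lift ν = (gradedProd ν J.cols).ofConv := by
  refine basis_ext fun I => ?_
  rw [LinearMap.comp_apply, ← basis_apply, lift, Module.Basis.constr_basis, map_sum, basis_apply]
  simp only [map_smul, coord_M, smul_eq_mul, mul_ite, mul_one, mul_zero]
  rw [Finset.sum_ite_eq']
  split_ifs with h
  · rfl
  · exact (gradedProd_M_of_ne ν J.cols I fun h' => h (mem_compositions.2 h'.symm)).symm

theorem lift_mem (ν : QSym l →ₗ[ℚ] ℚ) {n : Fin l → ℕ} {f : QSym l} (hf : f ∈ component n) :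
    lift ν f ∈ component n := by
  rw [mem_component]
  intro J hJ
  have h1 := LinearMap.congr_fun (coord_lift ν J) f
  rw [LinearMap.comp_apply] at h1
  rw [h1, apply_eq_sum] at hJ
  obtain ⟨I, hI, hI'⟩ := Finset.exists_ne_zero_of_sum_ne_zero hJ
  rw [← mem_component.1 hf I (Finsupp.mem_support_iff.1 hI)]
  by_contra hne
  exact hI' (by
    change _ • gradedProd ν J.cols (M I) = 0
    rw [gradedProd_M_of_ne ν _ I fun h' => hne h'.symm, smul_zero])

/-- Testing against `mul' ∘ (coord J ⊗ coord K)` is the form that fits convolution: applied to a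
coproduct, it is the convolution product of the two coordinates. -/
theorem tensor_ext {x y : QSym l ⊗[ℚ] QSym l}
    (h : ∀ J K, LinearMap.mul' ℚ ℚ (TensorProduct.map ((basis l).coord J) ((basis l).coord K) x) =
      LinearMap.mul' ℚ ℚ (TensorProduct.map ((basis l).coord J) ((basis l).coord K) y)) : x = y := by
  refine ((basis l).tensorProduct (basis l)).ext_elem fun p => ?_
  have key : ∀ z : QSym l ⊗[ℚ] QSym l, ((basis l).tensorProduct (basis l)).repr z p =
      LinearMap.mul' ℚ ℚ
        (TensorProduct.map ((basis l).coord p.1) ((basis l).coord p.2) z) := by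
    intro z
    induction z with
    | zero => simp
    | add a b ha hb => simp only [map_add, Finsupp.add_apply, ha, hb]
    | tmul a b =>
      rw [Module.Basis.tensorProduct_repr_tmul_apply, TensorProduct.map_tmul, LinearMap.mul'_apply,
        smul_eq_mul, mul_comm]
      rfl
  rw [key, key, h]

/-- `lift ν` as a morphism of coalgebras, given that `ζ` computes coordinates. -/
def liftHom {ζ : QSym l →ₗ[ℚ] ℚ} (hζ : ∀ I, ζ (M I) = if I.len ≤ 1 then 1 else 0)
    (ν : QSym l →ₗ[ℚ] ℚ) : QSym l →ₗc[ℚ] QSym l where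
  toLinearMap := lift ν
  counit_comp := by
    have h := coord_lift ν empty
    have h1 := gradedProd_eq_coord hζ empty
    -- The coordinate at the empty composition is the empty product, which is the counit.
    have h2 : (basis l).coord empty = CoalgebraStruct.counit (R := ℚ) := by
      rw [← h1]; rfl
    rw [← h2, h]
    exact h1
  map_comp_comul := by
    refine LinearMap.ext fun f => ?_
    refine tensor_ext fun J K => ?_
    have h1 : ∀ J K : VecComp l, toConv ((basis l).coord J) * toConv ((basis l).coord K) =
        toConv ((basis l).coord (J.append K)) := by
      intro J K
      rw [← gradedProd_eq_coord hζ, ← gradedProd_eq_coord hζ, ← gradedProd_eq_coord hζ]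
      exact (gradedProd_append ζ J.cols K.cols).symm
    have h2 : ((basis l).coord (J.append K)) (lift ν f) =
        (gradedProd ν J.cols * gradedProd ν K.cols) f := by
      rw [← gradedProd_append]
      exact LinearMap.congr_fun (coord_lift ν (J.append K)) f
    have h3 : ((basis l).coord (J.append K)) (lift ν f) =
        (toConv ((basis l).coord J) * toConv ((basis l).coord K)) (lift ν f) := by
      rw [h1]
    rw [LinearMap.convMul_apply] at h2 h3
    -- On `(Θ ⊗ Θ) ∘ Δ` the test gives the product of the `ν`-functionals of `J` and `K`; on `Δ ∘ Θ`
    -- it gives the coordinate at `JK`. Both factor through the list of columns of `JK`.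
    rw [LinearMap.comp_apply, LinearMap.comp_apply, ← LinearMap.comp_apply (TensorProduct.map _ _),
      ← TensorProduct.map_comp, coord_lift, coord_lift]
    exact h2.symm.trans h3

/-- In nonzero multidegree `n`, both `ζ` and `ν` are read off from the one-column composition `(n)`.
In degree `0` the map `lift ν` fixes `1` whatever `ν` is, hence the hypothesis on `ν (M empty)`. -/
theorem zeta_comp_lift {ζ : QSym l →ₗ[ℚ] ℚ} (hζ : ∀ I, ζ (M I) = if I.len ≤ 1 then 1 else 0)
    {ν : QSym l →ₗ[ℚ] ℚ} (hν : ν (M empty) = 1) : ζ ∘ₗ lift ν = ν := by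
  refine basis_ext fun I => ?_
  by_cases hI : I = empty
  · subst hI
    have h : lift ν (M empty) = M empty := by
      refine coord_ext fun J => ?_
      refine (LinearMap.congr_fun (coord_lift ν J) _).trans ?_
      rw [coord_M]
      by_cases hJ : J = empty
      · subst hJ
        exact convOne_M _
      · rw [if_neg fun h => hJ h.symm]
        exact gradedProd_M_of_ne _ _ _ fun h => hJ (total_eq_zero.1 (h.symm.trans rfl))
    rw [LinearMap.comp_apply, h, hν, hζ]
    exact if_pos (Nat.zero_le 1)
  · have hne : I.total ≠ 0 := fun h => hI (total_eq_zero.1 h)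
    let J : VecComp l := ⟨[I.total], by simpa using hne⟩
    have hg : ∀ ξ : QSym l →ₗ[ℚ] ℚ, gradedProd ξ J.cols = gradedPart ξ I.total := fun ξ => by
      change gradedProd ξ [I.total] = _
      rw [gradedProd_cons, gradedProd_nil, mul_one]
    have h1 := gradedPart_of_mem (n := I.total) (lift_mem ν (M_mem_component I)) ζ
    rw [if_pos rfl] at h1
    have h2 := LinearMap.congr_fun (coord_lift ν J) (M I)
    rw [hg, LinearMap.comp_apply, ← gradedProd_eq_coord hζ, hg] at h2
    refine h1.symm.trans (h2.trans ?_)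
    exact (gradedPart_M ν _ I).trans (if_pos rfl)

theorem eq_liftHom {ζ : QSym l →ₗ[ℚ] ℚ} (hζ : ∀ I, ζ (M I) = if I.len ≤ 1 then 1 else 0)
    {ν : QSym l →ₗ[ℚ] ℚ} {Θ : QSym l →ₗc[ℚ] QSym l}
    (hΘ : ∀ n, ∀ f ∈ component n, Θ f ∈ component n) (h : ζ ∘ₗ Θ.toLinearMap = ν) :
    Θ = liftHom hζ ν := by
  refine CoalgHom.ext fun f => coord_ext fun J => ?_
  have h1 := LinearMap.congr_fun (gradedProd_comp hΘ ζ J.cols) f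
  rw [h, gradedProd_eq_coord hζ] at h1
  exact h1.trans (LinearMap.congr_fun (coord_lift ν J) f).symm

/-! ### Evaluations in the first subscript, and the functional `ν` -/

/-- The polynomial obtained by setting all variables with subscripts other than the first to `0`. -/
def restrict (f : QSym l) : MvPolynomial (Fin l) ℚ :=
  ∑ n ∈ (zeta_support_finite f).toFinset, MvPolynomial.monomial n (MvPowerSeries.coeff n
    (MvPowerSeries.killCompl (firstVars l) (f : MvPowerSeries (Fin l × ℕ) ℚ)))

theorem coeff_restrict (f : QSym l) (n : Fin l →₀ ℕ) : (restrict f).coeff n =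
    MvPowerSeries.coeff n (MvPowerSeries.killCompl (firstVars l)
      (f : MvPowerSeries (Fin l × ℕ) ℚ)) := by
  unfold restrict
  rw [MvPolynomial.coeff_sum]
  simp only [MvPolynomial.coeff_monomial]
  rw [Finset.sum_ite_eq']
  split_ifs with h
  · rfl
  · by_contra h'
    exact h ((zeta_support_finite f).mem_toFinset.2 fun h'' => h' h''.symm)

theorem coe_restrict (f : QSym l) : (restrict f : MvPowerSeries (Fin l) ℚ) =
    MvPowerSeries.killCompl (firstVars l) (f : MvPowerSeries (Fin l × ℕ) ℚ) := by
  ext n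
  rw [MvPolynomial.coeff_coe, coeff_restrict]

/-- `restrict` as a morphism of algebras. -/
def restrictHom (l : ℕ) : QSym l →ₐ[ℚ] MvPolynomial (Fin l) ℚ :=
  AlgHom.ofLinearMap
    { toFun := restrict
      map_add' := fun f g => by
        ext n
        simp only [coeff_restrict, MvPolynomial.coeff_add]
        rw [← map_add, ← map_add]
        rfl
      map_smul' := fun r f => by
        ext n
        simp only [coeff_restrict, MvPolynomial.coeff_smul, RingHom.id_apply]
        rw [← map_smul, ← map_smul]
        rfl }
    (MvPolynomial.coe_injective (Fin l) ℚ (by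
      change ((restrict 1 : MvPolynomial (Fin l) ℚ) : MvPowerSeries (Fin l) ℚ) = _
      rw [coe_restrict, MvPolynomial.coe_one]
      exact map_one _))
    fun f g => MvPolynomial.coe_injective (Fin l) ℚ (by
      change ((restrict (f * g) : MvPolynomial (Fin l) ℚ) : MvPowerSeries (Fin l) ℚ) =
        ((restrict f * restrict g : MvPolynomial (Fin l) ℚ) : MvPowerSeries (Fin l) ℚ)
      rw [MvPolynomial.coe_mul, coe_restrict, coe_restrict, coe_restrict, ← map_mul]
      rfl)

/-- The character that sets the variables with the first subscript to `ε`, and all others to `0`. -/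
def evalFirst (l : ℕ) (ε : ℚ) : QSym l →ₐ[ℚ] ℚ := (MvPolynomial.aeval fun _ => ε).comp (restrictHom l)

theorem compress_embDomain_firstVars (n : Fin l →₀ ℕ) :
    (compress (Finsupp.embDomain (firstVars l) n)).cols = if n = 0 then [] else [⇑n] := by
  have happ : ∀ i, Finsupp.embDomain (firstVars l) n (i, 0) = n i := fun i =>
    Finsupp.embDomain_apply_self (firstVars l) n i
  have hs : (subscripts (Finsupp.embDomain (firstVars l) n)).sort = if n = 0 then [] else [0] := by
    refine sort_eq_of (by split_ifs <;> simp) fun x => ?_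
    rw [mem_subscripts]
    have hx : ∀ i, Finsupp.embDomain (firstVars l) n (i, x) ≠ 0 → x = 0 := by
      intro i hi
      by_contra hne
      refine hi (Finsupp.embDomain_of_notMem_range _ _ _ ?_)
      rintro ⟨i', h'⟩
      exact hne (congrArg Prod.snd h').symm
    split_ifs with h
    · subst h
      simp
    · rw [List.mem_singleton]
      constructor
      · rintro rfl
        obtain ⟨i, hi⟩ := Finsupp.ne_iff.1 h
        exact ⟨i, by rw [happ]; exact hi⟩
      · rintro ⟨i, hi⟩
        exact hx i hi
  change ((subscripts _).sort).map _ = _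
  rw [hs]
  split_ifs
  · rfl
  · simp only [List.map_cons, List.map_nil, happ]

theorem coeff_restrict_M (I : VecComp l) (n : Fin l →₀ ℕ) : (restrict (M I)).coeff n =
    if (if n = 0 then [] else [⇑n]) = I.cols then 1 else 0 := by
  rw [coeff_restrict, MvPowerSeries.coeff_killCompl, coeff_M]
  refine if_congr ?_ rfl rfl
  rw [← compress_embDomain_firstVars]
  exact ⟨fun h => h ▸ rfl, fun h => VecComp.ext h⟩

theorem evalFirst_M (ε : ℚ) (I : VecComp l) :
    evalFirst l ε (M I) = if I.len ≤ 1 then ε ^ I.weight else 0 := by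
  change MvPolynomial.aeval (fun _ => ε) (restrict (M I)) = _
  obtain ⟨L, hL⟩ := I
  match L, hL with
  | [], hL =>
    have h : restrict (M (⟨[], hL⟩ : VecComp l)) = 1 := by
      have h1 : M (⟨[], hL⟩ : VecComp l) = 1 := M_empty
      rw [h1]
      exact map_one (restrictHom l)
    rw [h, map_one]
    simp [len, weight]
  | [v], hL =>
    have h : restrict (M (⟨[v], hL⟩ : VecComp l)) =
        MvPolynomial.monomial (Finsupp.equivFunOnFinite.symm v) 1 := by
      ext n
      rw [coeff_restrict_M, MvPolynomial.coeff_monomial]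
      refine if_congr ?_ rfl rfl
      have hv : v ≠ 0 := hL v (by simp)
      rw [Equiv.symm_apply_eq]
      split_ifs with hn
      · subst hn
        exact ⟨fun h => absurd h (by simp), fun h => absurd h hv⟩
      · rw [List.cons.injEq]
        exact ⟨fun h => h.1.symm, fun h => ⟨h.symm, rfl⟩⟩
    rw [h, MvPolynomial.aeval_monomial, Finsupp.prod_fintype _ _ (by simp),
      Finset.prod_pow_eq_pow_sum]
    simp [len, weight, wt]
  | v :: w :: t, hL =>
    have h : restrict (M (⟨v :: w :: t, hL⟩ : VecComp l)) = 0 := by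
      ext n
      rw [coeff_restrict_M, if_neg]
      · simp
      · split_ifs <;> simp
    rw [h, map_zero, if_neg]
    simp [len]

theorem zeta_eq : zeta l = (evalFirst l 1).toLinearMap := by
  refine LinearMap.ext fun f => ?_
  change ∑ᶠ n : Fin l →₀ ℕ, MvPowerSeries.coeff n _ = MvPolynomial.aeval (fun _ => 1) (restrict f)
  simp_rw [← coeff_restrict]
  rw [finsum_eq_sum_of_support_subset (s := (restrict f).support), MvPolynomial.aeval_def,
    MvPolynomial.eval₂_eq]
  · simp
  · intro n hn
    exact MvPolynomial.mem_support_iff.2 hn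

theorem zeta_M (I : VecComp l) : zeta l (M I) = if I.len ≤ 1 then 1 else 0 := by
  rw [zeta_eq]
  refine (evalFirst_M 1 I).trans ?_
  rw [one_pow]

/-- The sign `(-1)^{|n|}` amounts to evaluating the variables at `-1` instead of `1`; this makes the
functional multiplicative. -/
theorem zetaK_top : zetaK (fun _ : Fin l => ⊤) = (evalFirst l (-1)).toLinearMap := by
  refine basis_ext fun I => ?_
  have h := (basis l).constr_basis ℚ (fun I => if ∀ i, (I.total i : ℕ∞) ≤ ⊤ then
    (-1) ^ I.weight * zeta l (M I) else zeta l (M I)) I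
  rw [basis_apply] at h
  refine h.trans ?_
  rw [if_pos fun i => le_top, zeta_M]
  refine Eq.trans ?_ (evalFirst_M (-1) I).symm
  rw [mul_ite, mul_one, mul_zero]

/-- The convolution inverse of `evalFirst l (-1)`. -/
def antipodeChar (l : ℕ) : WithConv (QSym l →ₗ[ℚ] ℚ) :=
  toConv (zetaK (fun _ => ⊤) ∘ₗ antipode l)

/-- An algebra morphism composed with `S * id = 1` remains a convolution identity. -/
theorem antipodeChar_mul :
    antipodeChar l * toConv (evalFirst l (-1)).toLinearMap = 1 := by
  have h := LinearMap.algHom_comp_convMul_distrib (evalFirst l (-1))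
    (toConv (antipode l)) (toConv (LinearMap.id : QSym l →ₗ[ℚ] QSym l))
  have h1 : toConv (antipode l) * toConv (LinearMap.id : QSym l →ₗ[ℚ] QSym l) = 1 :=
    (isUnit_id (l := l)).val_inv_mul
  rw [h1] at h
  apply ofConv_injective
  rw [antipodeChar, zetaK_top]
  refine h.symm.trans ?_
  refine LinearMap.ext fun f => ?_
  exact (evalFirst l (-1)).commutes _

theorem nu_top : toConv (nu fun _ : Fin l => ⊤) = antipodeChar l * toConv (zeta l) := rfl

theorem nu_M_empty : nu (fun _ : Fin l => ⊤) (M empty) = 1 := by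
  have h : (empty : VecComp l).len = 0 := rfl
  have ht : (empty : VecComp l).take 0 = empty := rfl
  have hd : (empty : VecComp l).drop 0 = empty := rfl
  have h1 := convMul_M (antipodeChar l) (toConv (evalFirst l (-1)).toLinearMap) empty
  have h2 := convMul_M (antipodeChar l) (toConv (zeta l)) empty
  rw [h, Finset.sum_range_one, ht, hd] at h1 h2
  have h3 : (toConv (evalFirst l (-1)).toLinearMap) (M (empty : VecComp l)) = 1 := by
    refine (evalFirst_M _ _).trans ?_
    simp [len, weight, empty]
  have h4 : (toConv (zeta l)) (M (empty : VecComp l)) = 1 := by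
    refine (zeta_M _).trans ?_
    simp [len, empty]
  rw [antipodeChar_mul, convOne_M, if_pos rfl, h3, mul_one] at h1
  rw [h4, ← h1, mul_one] at h2
  exact h2

/-! ### Factorizations of words into good words -/

/-- The sum of the multidegrees of the letters of a word. -/
def content {α : Type*} (c : α → Fin l → ℕ) (w : List α) : Fin l → ℕ := (w.map c).sum

section Content

variable {α : Type*} (c : α → Fin l → ℕ)

theorem content_cons (a : α) (w : List α) : content c (a :: w) = c a + content c w := by
  simp [content]

theorem content_append (w w' : List α) : content c (w ++ w') = content c w + content c w' := by
  simp [content]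

theorem content_flatten (L : List (List α)) : content c L.flatten = (L.map (content c)).sum := by
  induction L with
  | nil => rfl
  | cons x L ih => rw [List.flatten_cons, content_append, ih, List.map_cons, List.sum_cons]

variable {c}

theorem eq_nil_of_content_eq_zero (hc : ∀ a, c a ≠ 0) {w : List α} (h : content c w = 0) :
    w = [] := by
  cases w with
  | nil => rfl
  | cons a w =>
    rw [content_cons, add_comm] at h
    exact absurd h (add_ne_zero_right _ (hc a))

/-- Of two prefixes of one word, one extends the other by a word of content zero, which is empty.
This gives the uniqueness of factorizations with prescribed contents. -/
theorem append_inj_of_content (hc : ∀ a, c a ≠ 0) {x y x' y' : List α} (h : x ++ y = x' ++ y')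
    (hx : content c x = content c x') : x = x' ∧ y = y' := by
  rcases List.append_eq_append_iff.1 h with ⟨z, rfl, rfl⟩ | ⟨z, rfl, rfl⟩
  · rw [content_append] at hx
    have hz : z = [] := eq_nil_of_content_eq_zero hc (by simpa using hx)
    subst hz
    simp
  · rw [content_append] at hx
    have hz : z = [] := eq_nil_of_content_eq_zero hc (by simpa using hx)
    subst hz
    simp

end Content

/-- If `G` is a family indexed by words whose coproduct is deconcatenation and `ν (G x)` is
`2` times a sign for `good` nonempty words and `0` otherwise, then the graded products of `ν` on
`G w` detect the factorizations of `w` into good words. -/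
theorem gradedProd_family {α : Type*} {c : α → Fin l → ℕ} (hc : ∀ a, c a ≠ 0) {G : List α → QSym l}
    (hΔ : ∀ (f g : WithConv (QSym l →ₗ[ℚ] ℚ)) (w : List α), (f * g) (G w) =
      ∑ k ∈ Finset.range (w.length + 1), f (G (w.take k)) * g (G (w.drop k)))
    (hmem : ∀ w, G w ∈ component (content c w))
    (hone : ∀ w, (1 : WithConv (QSym l →ₗ[ℚ] ℚ)) (G w) = if w = [] then 1 else 0)
    {ν : QSym l →ₗ[ℚ] ℚ} {sgn : α → ℚ} {good : List α → Prop}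
    (hν : ∀ w, w ≠ [] → ν (G w) = if good w then 2 * (w.map sgn).prod else 0)
    (J : List (Fin l → ℕ)) (hJ : ∀ v ∈ J, v ≠ 0) (w : List α) :
    gradedProd ν J (G w) =
      if ∃ L : List (List α), w = L.flatten ∧ J = L.map (content c) ∧ ∀ x ∈ L, good x then
        (w.map sgn).prod * 2 ^ J.length else 0 := by
  induction J generalizing w with
  | nil =>
    rw [gradedProd_nil, hone]
    have h : (∃ L : List (List α), w = L.flatten ∧ [] = L.map (content c) ∧ ∀ x ∈ L, good x) ↔
        w = [] := by
      constructor
      · rintro ⟨L, rfl, h, -⟩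
        rw [List.map_eq_nil_iff.1 h.symm]
        rfl
      · rintro rfl
        exact ⟨[], rfl, rfl, by simp⟩
    simp only [h]
    split_ifs with hw
    · subst hw
      simp
    · rfl
  | cons j J ih =>
    have hj : j ≠ 0 := hJ j (by simp)
    have ih' := ih fun v hv => hJ v (by simp [hv])
    rw [gradedProd_cons, hΔ]
    -- One cut contributes the factor `2` and the sign of `x`, times the value for `y`; the signs
    -- multiply to that of `x ++ y`, which does not depend on the cut.
    have hterm : ∀ x y : List α, gradedPart ν j (G x) * gradedProd ν J (G y) =
        if (content c x = j ∧ good x) ∧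
          ∃ L : List (List α), y = L.flatten ∧ J = L.map (content c) ∧ ∀ x ∈ L, good x then
        ((x ++ y).map sgn).prod * 2 ^ (J.length + 1) else 0 := by
      intro x y
      rw [gradedPart_of_mem (hmem x), ih']
      by_cases hx : content c x = j
      · have hx0 : x ≠ [] := by
          rintro rfl
          exact hj hx.symm
        rw [if_pos hx, hν x hx0, List.map_append, List.prod_append]
        by_cases hg : good x
        · simp only [hx, hg, and_self, true_and, if_true, mul_ite, mul_zero]
          split_ifs
          · ring
          · rfl
        · simp [hg]
      · simp [hx]
    split_ifs with h
    · obtain ⟨L, rfl, hL, hgood⟩ := h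
      cases L with
      | nil => simp at hL
      | cons x L =>
        rw [List.map_cons, List.cons.injEq] at hL
        rw [List.flatten_cons, Finset.sum_eq_single x.length]
        · rw [List.take_left, List.drop_left, hterm, if_pos, List.length_cons]
          exact ⟨⟨hL.1.symm, hgood x (by simp)⟩, L, rfl, hL.2, fun x hx => hgood x (by simp [hx])⟩
        -- Another cut would give a different prefix with the same content.
        · intro k hk hk'
          rw [hterm, if_neg]
          rintro ⟨⟨h1, -⟩, -⟩
          have h2 := (append_inj_of_content hc (List.take_append_drop k (x ++ L.flatten))
            (h1.trans hL.1)).1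
          apply hk'
          have h3 := congrArg List.length h2
          rw [List.length_take] at h3
          rw [Finset.mem_range] at hk
          omega
        · intro h
          simp at h
    · refine Finset.sum_eq_zero fun k _ => ?_
      rw [hterm, if_neg]
      rintro ⟨⟨h1, h2⟩, L, h3, h4, h5⟩
      refine h ⟨w.take k :: L, ?_, ?_, ?_⟩
      · rw [List.flatten_cons, ← h3, List.take_append_drop]
      · rw [List.map_cons, h1, ← h4]
      · intro x hx
        rcases List.mem_cons.1 hx with rfl | hx
        · exact h2
        · exact h5 x hx

end QSym

/-! ### Blocks ending in a column of odd weight -/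

namespace VecComp

variable {l : ℕ}

/-- The last column exists and has odd weight. -/
def lastOddCols (w : List (Fin l → ℕ)) : Prop := ∃ v ∈ w.getLast?, Odd (wt v)

theorem lastOddCols_append {w : List (Fin l → ℕ)} (hw : lastOddCols w) (x : List (Fin l → ℕ)) :
    lastOddCols (x ++ w) := by
  obtain ⟨v, hv, h⟩ := hw
  refine ⟨v, ?_, h⟩
  rw [List.getLast?_append]
  simp [Option.mem_def.1 hv]

theorem lastOddCols_cons {w : List (Fin l → ℕ)} (hw : w ≠ []) (v : Fin l → ℕ) :
    lastOddCols (v :: w) ↔ lastOddCols w := by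
  unfold lastOddCols
  rw [List.getLast?_cons_of_ne_nil hw]

/-- A final odd column closes its block, so the accumulator restarts at `0` on `y`. -/
theorem oddCols_append {x : List (Fin l → ℕ)} (hx : lastOddCols x) (y : List (Fin l → ℕ))
    (acc : Fin l → ℕ) : oddCols acc (x ++ y) = oddCols acc x ++ oddCols 0 y := by
  induction x generalizing acc with
  | nil => simp [lastOddCols] at hx
  | cons v x ih =>
    rw [List.cons_append]
    by_cases hx0 : x = []
    · subst hx0
      have hv : Odd (wt v) := by simpa [lastOddCols] using hx
      simp [oddCols, hv]
    · have ih' := ih ((lastOddCols_cons hx0 v).1 hx)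
      rw [oddCols, oddCols.eq_2 acc v x]
      split_ifs
      · rw [ih', List.cons_append]
      · rw [ih']

theorem sum_oddCols {x : List (Fin l → ℕ)} (hx : lastOddCols x) (acc : Fin l → ℕ) :
    (oddCols acc x).sum = acc + x.sum := by
  induction x generalizing acc with
  | nil => simp [lastOddCols] at hx
  | cons v x ih =>
    by_cases hx0 : x = []
    · subst hx0
      have hv : Odd (wt v) := by simpa [lastOddCols] using hx
      simp [oddCols, hv]
    · have ih' := ih ((lastOddCols_cons hx0 v).1 hx)
      unfold oddCols
      split_ifs
      · rw [List.sum_cons, ih', List.sum_cons, zero_add, add_assoc]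
      · rw [ih', List.sum_cons, add_assoc]

/-- A nonempty initial run of blocks is lifted to the prefix of `w` that stops right after the odd
column closing the last of them. -/
theorem exists_of_oddCols_eq_append {w A B : List (Fin l → ℕ)} {acc : Fin l → ℕ} (hA : A ≠ [])
    (h : oddCols acc w = A ++ B) :
    ∃ x y, w = x ++ y ∧ lastOddCols x ∧ oddCols acc x = A ∧ oddCols 0 y = B := by
  induction w generalizing acc A with
  | nil =>
    rw [oddCols] at h
    exact absurd (List.append_eq_nil_iff.1 h.symm).1 hA
  | cons v t ih =>
    unfold oddCols at h
    by_cases hv : Odd (wt v)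
    · rw [if_pos hv] at h
      obtain ⟨a, A, rfl⟩ := List.exists_cons_of_ne_nil hA
      rw [List.cons_append, List.cons.injEq] at h
      by_cases hA' : A = []
      · subst hA'
        exact ⟨[v], t, rfl, ⟨v, rfl, hv⟩, by simp [oddCols, hv, h.1], h.2⟩
      · obtain ⟨x, y, rfl, hx, h1, h2⟩ := ih hA' h.2
        refine ⟨v :: x, y, rfl, lastOddCols_append hx [v], ?_, h2⟩
        unfold oddCols
        rw [if_pos hv, h1, h.1]
    · rw [if_neg hv] at h
      obtain ⟨x, y, rfl, hx, h1, h2⟩ := ih hA h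
      refine ⟨v :: x, y, rfl, lastOddCols_append hx [v], ?_, h2⟩
      rw [oddCols, if_neg hv, h1]

theorem oddCols_ne_nil {w : List (Fin l → ℕ)} (hw : lastOddCols w) (acc : Fin l → ℕ) :
    oddCols acc w ≠ [] := by
  induction w generalizing acc with
  | nil => simp [lastOddCols] at hw
  | cons v x ih =>
    unfold oddCols
    split_ifs with hv
    · simp
    · refine ih ((lastOddCols_cons ?_ v).1 hw) _
      rintro rfl
      exact hv (by simpa [lastOddCols] using hw)

/-- Cutting `w` only after odd columns is the same as cutting between columns of `odd(w)`. The
condition on `w` excludes trailing even columns, which `oddCols` discards. -/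
theorem exists_odd_blocks {w J : List (Fin l → ℕ)} (hJ : ∀ v ∈ J, v ≠ 0) :
    (∃ L : List (List (Fin l → ℕ)), w = L.flatten ∧ J = L.map List.sum ∧ ∀ x ∈ L, lastOddCols x) ↔
      (w = [] ∨ lastOddCols w) ∧
        ∃ K : List (List (Fin l → ℕ)), oddCols 0 w = K.flatten ∧ J = K.map List.sum := by
  constructor
  · rintro ⟨L, rfl, rfl, hL⟩
    clear hJ
    induction L with
    | nil => exact ⟨Or.inl rfl, [], rfl, rfl⟩
    | cons x L ih =>
      obtain ⟨h1, K, h2, h3⟩ := ih fun x hx => hL x (by simp [hx])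
      have hx := hL x (by simp)
      rw [List.flatten_cons]
      refine ⟨Or.inr ?_, oddCols 0 x :: K, ?_, ?_⟩
      · rcases h1 with h1 | h1
        · rwa [h1, List.append_nil]
        · exact lastOddCols_append h1 x
      · rw [oddCols_append hx, h2, List.flatten_cons]
      · rw [List.map_cons, List.map_cons, h3, sum_oddCols hx, zero_add]
  · rintro ⟨hw, K, hK, rfl⟩
    induction K generalizing w with
    | nil =>
      refine ⟨[], ?_, rfl, by simp⟩
      rcases hw with hw | hw
      · exact hw
      · exact absurd hK (oddCols_ne_nil hw 0)
    | cons A K ih =>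
      have hA : A ≠ [] := by
        rintro rfl
        exact hJ 0 (by simp) rfl
      obtain ⟨x, y, rfl, hx, h1, h2⟩ := exists_of_oddCols_eq_append hA hK
      have hy : y = [] ∨ lastOddCols y := by
        by_cases hy : y = []
        · exact Or.inl hy
        · right
          rcases hw with hw | hw
          · exact absurd (List.append_eq_nil_iff.1 hw).2 hy
          · obtain ⟨v, hv, h⟩ := hw
            refine ⟨v, ?_, h⟩
            rwa [List.getLast?_append_of_ne_nil _ hy] at hv
      obtain ⟨L, h3, h4, h5⟩ := ih hy h2 fun v hv => hJ v (List.mem_cons_of_mem _ hv)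
      refine ⟨x :: L, by rw [List.flatten_cons, h3], ?_, ?_⟩
      · rw [List.map_cons, List.map_cons, h4, ← h1, sum_oddCols hx, zero_add]
      · intro z hz
        rcases List.mem_cons.1 hz with rfl | hz
        · exact hx
        · exact h5 z hz

theorem refines_iff (J I : VecComp l) : J.Refines I ↔
    ∃ K : List (List (Fin l → ℕ)), I.cols = K.flatten ∧ J.cols = K.map List.sum := by
  constructor
  · rintro ⟨Js, h1, h2⟩
    exact ⟨Js.map cols, h1, by rw [h2, List.map_map]; rfl⟩
  · rintro ⟨K, h1, h2⟩
    refine ⟨K.pmap (fun x hx => ⟨x, hx⟩) fun x hx v hv =>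
      I.ne_zero v (h1 ▸ List.mem_flatten.2 ⟨x, hx, hv⟩), ?_, ?_⟩
    · rw [List.map_pmap]
      simpa using h1
    · rw [List.map_pmap]
      simpa [total, List.pmap_eq_map] using h2

/-- The vector composition whose columns are given as elements of a subtype. -/
def ofList (w : List {v : Fin l → ℕ // v ≠ 0}) : VecComp l :=
  ⟨w.map Subtype.val, fun v hv => by
    obtain ⟨u, -, rfl⟩ := List.mem_map.1 hv
    exact u.2⟩

theorem ofList_surjective : Function.Surjective (ofList (l := l)) := by
  intro I
  refine ⟨I.cols.attachWith _ I.ne_zero, VecComp.ext ?_⟩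
  exact List.attachWith_map_subtype_val _

theorem ofList_eq_empty {w : List {v : Fin l → ℕ // v ≠ 0}} : ofList w = empty ↔ w = [] := by
  rw [QSym.eq_empty_iff]
  simp [len, ofList]

end VecComp

/-! ### The map on the monomial basis -/

namespace QSym

open VecComp WithConv

variable {l : ℕ}

/-- The second factor vanishes on more than one column, so only the cuts after the last column and
just before it survive. -/
theorem conv_evalFirst_M (f : WithConv (QSym l →ₗ[ℚ] ℚ)) (ε : ℚ) (t : List {v : Fin l → ℕ // v ≠ 0})
    (v : {v : Fin l → ℕ // v ≠ 0}) :
    (f * toConv (evalFirst l ε).toLinearMap) (M (ofList (t ++ [v]))) =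
      f (M (ofList (t ++ [v]))) + f (M (ofList t)) * ε ^ wt v.1 := by
  have hlen : (ofList (t ++ [v])).len = t.length + 1 := by simp [len, ofList]
  have hev : ∀ I : VecComp l, (toConv (evalFirst l ε).toLinearMap) (M I) =
    if I.len ≤ 1 then ε ^ I.weight else 0 := evalFirst_M ε
  have h1 : (ofList (t ++ [v])).take t.length = ofList t := VecComp.ext (by simp [take, ofList])
  have h2 : ((ofList (t ++ [v])).drop t.length).cols = [v.1] := by simp [drop, ofList]
  rw [convMul_M, Finset.sum_range_succ, hlen, Finset.sum_range_succ, Finset.sum_eq_zero, zero_add,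
    ← hlen, take_len, h1, add_comm]
  · congr 1
    · rw [hev, if_pos (by rw [len_drop]; omega)]
      have : ((ofList (t ++ [v])).drop (ofList (t ++ [v])).len).weight = 0 := by
        simp [weight, drop, len]
      rw [this, pow_zero, mul_one]
    · rw [hev, if_pos (by rw [len_drop]; omega)]
      simp [weight, h2]
  · intro k hk
    rw [Finset.mem_range] at hk
    rw [hev, if_neg, mul_zero]
    rw [len_drop]
    omega

/-- Being inverse to evaluation at `-1` gives the recursion `χ(M_{tv}) = -(-1)^{|v|} χ(M_t)`. -/
theorem antipodeChar_M (w : List {v : Fin l → ℕ // v ≠ 0}) :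
    antipodeChar l (M (ofList w)) = (w.map fun v => -(-1 : ℚ) ^ wt v.1).prod := by
  induction w using List.reverseRecOn with
  | nil =>
    have h := nu_M_empty (l := l)
    have h1 := convMul_M (antipodeChar l) (toConv (zeta l)) empty
    have h2 : (empty : VecComp l).len + 1 = 1 := rfl
    rw [h2, Finset.sum_range_one] at h1
    have h3 : (toConv (zeta l)) (M ((empty : VecComp l).drop 0)) = 1 := zeta_M _
    rw [h3, mul_one] at h1
    exact h1.symm.trans h
  | append_singleton t v ih =>
    have h := conv_evalFirst_M (antipodeChar l) (-1) t v
    rw [antipodeChar_mul, convOne_M, if_neg (by rw [ofList_eq_empty]; simp), ih] at h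
    rw [List.map_append, List.prod_append, List.map_singleton, List.prod_singleton]
    linarith

/-- The two surviving cuts add up to `χ(M_t) (1 - (-1)^{|v|})`. For `v` of odd weight the sign of
`v` is `+1`, so the product over `t` is also the product over the whole word. -/
theorem nu_M (w : List {v : Fin l → ℕ // v ≠ 0}) (hw : w ≠ []) :
    nu (fun _ : Fin l => ⊤) (M (ofList w)) = if lastOddCols (w.map Subtype.val) then
      2 * (w.map fun v => -(-1 : ℚ) ^ wt v.1).prod else 0 := by
  induction w using List.reverseRecOn with
  | nil => exact absurd rfl hw
  | append_singleton t v =>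
    have h := conv_evalFirst_M (antipodeChar l) 1 t v
    rw [← zeta_eq, ← nu_top, antipodeChar_M, antipodeChar_M] at h
    have h1 : lastOddCols ((t ++ [v]).map Subtype.val) ↔ Odd (wt v.1) := by simp [lastOddCols]
    refine Eq.trans h ?_
    rw [if_congr h1 rfl rfl]
    simp only [List.map_append, List.prod_append, List.map_singleton, List.prod_singleton]
    split_ifs with hv
    · rw [hv.neg_one_pow]
      ring
    · rw [(Nat.not_odd_iff_even.1 hv).neg_one_pow]
      ring

theorem prod_sign (L : List (Fin l → ℕ)) :
    (L.map fun v => -(-1 : ℚ) ^ wt v).prod = (-1) ^ (L.length + (L.map wt).sum) := by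
  induction L with
  | nil => simp
  | cons v L ih =>
    rw [List.map_cons, List.prod_cons, ih, List.length_cons, List.map_cons, List.sum_cons]
    ring

/-- Instance of `gradedProd_family` with nonzero columns as letters and `lastOddCols` as goodness.
The subtype makes every letter have nonzero content. -/
theorem gradedProd_nu_M (I J : VecComp l) :
    gradedProd (nu fun _ : Fin l => ⊤) J.cols (M I) =
      if (I = empty ∨ I.LastOdd) ∧ J.Refines I.odd then
        (-1) ^ (I.len + I.weight) * 2 ^ J.len else 0 := by
  obtain ⟨w, rfl⟩ := ofList_surjective I
  have hcontent : ∀ x : List {v : Fin l → ℕ // v ≠ 0},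
      content Subtype.val x = (x.map Subtype.val).sum := fun _ => rfl
  have h := gradedProd_family (c := fun v : {v : Fin l → ℕ // v ≠ 0} => v.1) (fun v => v.2)
    (G := fun w => M (ofList w)) (fun f g w => ?_) (fun w => ?_) (fun w => ?_) nu_M J.cols J.ne_zero w
  · rw [h]
    refine if_congr ?_ ?_ rfl
    · have h1 := exists_odd_blocks (w := w.map Subtype.val) J.ne_zero
      rw [refines_iff]
      refine Iff.trans ⟨?_, ?_⟩ (h1.trans (and_congr (or_congr ?_ Iff.rfl) Iff.rfl))
      · rintro ⟨L, rfl, h2, h3⟩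
        refine ⟨L.map (List.map Subtype.val), List.map_flatten, ?_, ?_⟩
        · rw [h2, List.map_map]
          rfl
        · intro x hx
          obtain ⟨y, hy, rfl⟩ := List.mem_map.1 hx
          exact h3 y hy
      · rintro ⟨L, h2, h3, h4⟩
        have hne : ∀ x ∈ L, ∀ v ∈ x, v ≠ 0 := by
          intro x hx v hv
          have : v ∈ w.map Subtype.val := h2 ▸ List.mem_flatten.2 ⟨x, hx, hv⟩
          obtain ⟨u, -, rfl⟩ := List.mem_map.1 this
          exact u.2
        obtain ⟨L', rfl⟩ : ∃ L' : List (List {v : Fin l → ℕ // v ≠ 0}),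
            L = L'.map (List.map Subtype.val) := by
          refine ⟨L.pmap (fun x hx => x.attachWith _ hx) hne, ?_⟩
          rw [List.map_pmap]
          simp
        refine ⟨L', ?_, ?_, ?_⟩
        · rw [← List.map_flatten] at h2
          exact List.map_injective_iff.2 Subtype.val_injective h2
        · rw [h3, List.map_map]
          rfl
        · intro x hx
          exact h4 _ (List.mem_map_of_mem hx)
      · rw [ofList_eq_empty, List.map_eq_nil_iff]
    · have h2 := prod_sign (w.map Subtype.val)
      rw [List.map_map] at h2
      congr 1
  · rw [convMul_M]
    have h1 : (ofList w).len = w.length := by simp [len, ofList]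
    rw [h1]
    refine Finset.sum_congr rfl fun k _ => ?_
    have h2 : (ofList w).take k = ofList (w.take k) := VecComp.ext List.map_take.symm
    have h3 : (ofList w).drop k = ofList (w.drop k) := VecComp.ext List.map_drop.symm
    rw [h2, h3]
  · exact M_mem_component (ofList w)
  · rw [convOne_M]
    exact if_congr ofList_eq_empty rfl rfl

theorem coord_eta (I J : VecComp l) :
    (basis l).coord J (eta I) = if J.Refines I then 2 ^ J.len else 0 := by
  unfold eta
  rw [map_sum]
  simp only [map_smul, coord_M, smul_eq_mul, mul_ite, mul_one, mul_zero]
  rw [Finset.sum_ite_eq']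
  refine if_congr ?_ rfl rfl
  rw [Finset.mem_filter, mem_compositions]
  refine ⟨fun h => h.2, fun h => ⟨?_, h⟩⟩
  obtain ⟨Js, h1, h2⟩ := h
  unfold total
  rw [h1, h2]
  clear h1 h2
  induction Js with
  | nil => rfl
  | cons K Js ih => rw [List.map_cons, List.sum_cons, ih, List.map_cons, List.flatten_cons,
      List.sum_append]; rfl

theorem lift_nu_M (I : VecComp l) : lift (nu fun _ : Fin l => ⊤) (M I) =
    if I = VecComp.empty then 1
    else if I.LastOdd then (-1 : ℚ) ^ (I.len + I.weight) • eta I.odd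
    else 0 := by
  refine coord_ext fun J => ?_
  refine (LinearMap.congr_fun (coord_lift _ J) _).trans ?_
  refine (gradedProd_nu_M I J).trans ?_
  split_ifs with h1 h2 h3 h2 h3
  · subst h2
    have : J = empty := by
      obtain ⟨K, h3, h4⟩ := (refines_iff _ _).1 h1.2
      refine total_eq_zero.1 ?_
      unfold total
      rw [h4, ← List.sum_flatten, ← h3]
      rfl
    subst this
    rw [← M_empty, coord_M]
    simp [len, weight, empty]
  · rw [map_smul, coord_eta, if_pos h1.2, smul_eq_mul]
  · exact absurd h1.1 (by simp [h2, h3])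
  · subst h2
    rw [← M_empty, coord_M, if_neg]
    rintro rfl
    exact h1 ⟨Or.inl rfl, [], rfl, rfl⟩
  · rw [map_smul, coord_eta, if_neg fun h => h1 ⟨Or.inr h3, h⟩, smul_zero]
  · rw [map_zero]

/-! ### Cutting sequences of descent flags -/

/-- All entries but the last are equal to `b`. -/
def InitAll (b : Bool) (f : List Bool) : Prop := ∀ x ∈ f.dropLast, x = b

theorem initAll_nil (b : Bool) : InitAll b [] := by simp [InitAll]

theorem initAll_singleton (b x : Bool) : InitAll b [x] := by simp [InitAll]

theorem initAll_cons_cons (b x y : Bool) (f : List Bool) :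
    InitAll b (x :: y :: f) ↔ x = b ∧ InitAll b (y :: f) := by simp [InitAll]

theorem initAll_cons {f : List Bool} (hf : f ≠ []) (b x : Bool) :
    InitAll b (x :: f) ↔ x = b ∧ InitAll b f := by
  obtain ⟨y, f, rfl⟩ := List.exists_cons_of_ne_nil hf
  exact initAll_cons_cons b x y f

/-- All entries but the last form a sequence of `true`s followed by a sequence of `false`s. -/
def NoPeak : List Bool → Prop
  | [] => True
  | x :: f => if x then NoPeak f else InitAll false (x :: f)

/-- The signed number of ways to cut a sequence of flags into a part with all inner flags set
and a part with no inner flag set. -/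
def cutSum (ε : ℚ) (f : List Bool) : ℚ :=
  ∑ k ∈ Finset.range (f.length + 1), (if InitAll true (f.take k) then 1 else 0) *
    if InitAll false (f.drop k) then ε ^ (f.drop k).length else 0

theorem cutSum_singleton (ε : ℚ) (x : Bool) : cutSum ε [x] = ε + 1 := by
  simp [cutSum, Finset.sum_range_succ, initAll_nil, initAll_singleton]

/-- A leading `true` is harmless in the left part and forbids the cut before it, where it would be
an inner flag of the right part. -/
theorem cutSum_true_cons (ε : ℚ) {f : List Bool} (hf : f ≠ []) :
    cutSum ε (true :: f) = cutSum ε f := by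
  unfold cutSum
  rw [List.length_cons, Finset.sum_range_succ']
  have h0 : ¬ InitAll false ((true :: f).drop 0) := by
    rw [List.drop_zero, initAll_cons hf]
    simp
  rw [if_neg h0, mul_zero, add_zero]
  refine Finset.sum_congr rfl fun k _ => ?_
  rw [List.take_succ_cons, List.drop_succ_cons]
  congr 1
  refine if_congr ?_ rfl rfl
  by_cases h : f.take k = []
  · rw [h]
    exact ⟨fun _ => initAll_nil _, fun _ => initAll_singleton _ _⟩
  · rw [initAll_cons h]
    simp

/-- A leading `false` allows at most one letter in the left part. The cuts at `0` and `1` contribute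
`ε^{n+1}` and `ε^n`, with `n` the length of `f`. -/
theorem cutSum_false_cons (ε : ℚ) {f : List Bool} (hf : f ≠ []) :
    cutSum ε (false :: f) = if InitAll false f then ε ^ f.length * (ε + 1) else 0 := by
  unfold cutSum
  rw [List.length_cons, Finset.sum_range_succ', Finset.sum_range_succ', Finset.sum_eq_zero]
  · have h : InitAll false (false :: f) ↔ InitAll false f := by
      rw [initAll_cons hf]
      simp
    simp only [List.take_succ_cons, List.take_zero, List.drop_succ_cons, List.drop_zero,
      initAll_nil, initAll_singleton, if_true, one_mul, h, List.length_cons, zero_add]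
    split_ifs
    · ring
    · ring
  · intro k hk
    rw [Finset.mem_range] at hk
    rw [List.take_succ_cons, if_neg, zero_mul]
    rw [initAll_cons]
    · simp
    · intro h
      have := congrArg List.length h
      rw [List.length_take, List.length_nil] at this
      omega

theorem cutSum_neg_one {f : List Bool} (hf : f ≠ []) : cutSum (-1) f = 0 := by
  induction f with
  | nil => exact absurd rfl hf
  | cons x f ih =>
    by_cases h : f = []
    · subst h
      rw [cutSum_singleton]
      norm_num
    · cases x
      · rw [cutSum_false_cons _ h]
        simp
      · rw [cutSum_true_cons _ h, ih h]

theorem cutSum_one {f : List Bool} (hf : f ≠ []) : cutSum 1 f = if NoPeak f then 2 else 0 := by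
  induction f with
  | nil => exact absurd rfl hf
  | cons x f ih =>
    by_cases h : f = []
    · subst h
      rw [cutSum_singleton, if_pos]
      · norm_num
      · cases x <;> simp [NoPeak, initAll_singleton]
    · cases x
      · rw [cutSum_false_cons _ h]
        refine if_congr ?_ (by norm_num) rfl
        rw [NoPeak, initAll_cons h]
        simp
      · rw [cutSum_true_cons _ h, ih h]
        simp [NoPeak]

/-! ### Ribbons of words with marked descents -/

/-- The multidegree of a letter; the flag says whether there is a descent after the letter. -/
def letterDeg (a : Fin l × Bool) : Fin l → ℕ := Pi.single a.1 1

theorem letterDeg_ne_zero (a : Fin l × Bool) : letterDeg a ≠ 0 := by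
  simp [letterDeg]

/-- The flags of a word. -/
def flags (w : List (Fin l × Bool)) : List Bool := w.map Prod.snd

theorem flags_eq_nil {w : List (Fin l × Bool)} : flags w = [] ↔ w = [] := List.map_eq_nil_iff

theorem length_flags (w : List (Fin l × Bool)) : (flags w).length = w.length := List.length_map _

theorem flags_take (w : List (Fin l × Bool)) (k : ℕ) : flags (w.take k) = (flags w).take k :=
  List.map_take

theorem flags_drop (w : List (Fin l × Bool)) (k : ℕ) : flags (w.drop k) = (flags w).drop k :=
  List.map_drop

theorem wt_content (w : List (Fin l × Bool)) : wt (content letterDeg w) = w.length := by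
  induction w with
  | nil => simp [wt, content]
  | cons a w ih =>
    have h : wt (letterDeg a + content letterDeg w) = wt (letterDeg a) + wt (content letterDeg w) := by
      simp [wt, Finset.sum_add_distrib]
    have h1 : wt (letterDeg a) = 1 := by simp [wt, letterDeg]
    rw [content_cons, h, ih, h1, List.length_cons, add_comm]

/-- `K` is the sequence of contents of a factorization of `w` that cuts `w` at least at all
descents. -/
def Compat (w : List (Fin l × Bool)) (K : List (Fin l → ℕ)) : Prop :=
  ∃ L : List (List (Fin l × Bool)), w = L.flatten ∧ K = L.map (content letterDeg) ∧
    ∀ x ∈ L, InitAll false (flags x)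

theorem Compat.append {w w' : List (Fin l × Bool)} {K K' : List (Fin l → ℕ)} (h : Compat w K)
    (h' : Compat w' K') : Compat (w ++ w') (K ++ K') := by
  obtain ⟨L, rfl, rfl, hL⟩ := h
  obtain ⟨L', rfl, rfl, hL'⟩ := h'
  refine ⟨L ++ L', by rw [List.flatten_append], by rw [List.map_append], fun x hx => ?_⟩
  exact (List.mem_append.1 hx).elim (hL x) (hL' x)

theorem Compat.content_eq {w : List (Fin l × Bool)} {K : List (Fin l → ℕ)} (h : Compat w K) :
    K.sum = content letterDeg w := by
  obtain ⟨L, rfl, rfl, -⟩ := h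
  rw [content_flatten]

theorem Compat.weight_eq {w : List (Fin l × Bool)} {K : VecComp l} (h : Compat w K.cols) :
    K.weight = w.length := by
  rw [← wt_total, ← wt_content, ← h.content_eq]
  rfl

/-- Each letter has weight one, so the weight of the first `i` columns is the position of the cut in
`w`. -/
theorem Compat.take_drop {w : List (Fin l × Bool)} {K : VecComp l} (h : Compat w K.cols) (i : ℕ) :
    Compat (w.take (K.take i).weight) (K.take i).cols ∧
      Compat (w.drop (K.take i).weight) (K.drop i).cols := by
  obtain ⟨L, rfl, hK, hL⟩ := h
  have h1 : Compat (L.take i).flatten (K.take i).cols :=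
    ⟨L.take i, rfl, by rw [List.map_take, ← hK]; rfl, fun x hx => hL x (List.mem_of_mem_take hx)⟩
  have h2 : Compat (L.drop i).flatten (K.drop i).cols :=
    ⟨L.drop i, rfl, by rw [List.map_drop, ← hK]; rfl, fun x hx => hL x (List.mem_of_mem_drop hx)⟩
  have h3 : L.flatten = (L.take i).flatten ++ (L.drop i).flatten := by
    rw [← List.flatten_append, List.take_append_drop]
  rw [h1.weight_eq, h3, List.take_left, List.drop_left]
  exact ⟨h1, h2⟩

/-- The quasi-ribbon function of a word with marked descents. -/
def ribbon (w : List (Fin l × Bool)) : QSym l :=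
  ∑ K ∈ compositions (content letterDeg w) with Compat w K.cols, M K

theorem mem_ribbon_index {w : List (Fin l × Bool)} {K : VecComp l} :
    K ∈ (compositions (content letterDeg w)).filter (fun K => Compat w K.cols) ↔
      Compat w K.cols := by
  rw [Finset.mem_filter, mem_compositions]
  exact ⟨fun h => h.2, fun h => ⟨h.content_eq, h⟩⟩

theorem apply_ribbon {V : Type*} [AddCommGroup V] [Module ℚ V] (f : QSym l →ₗ[ℚ] V)
    (w : List (Fin l × Bool)) : f (ribbon w) =
      ∑ K ∈ compositions (content letterDeg w) with Compat w K.cols, f (M K) :=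
  map_sum f _ _

/-- A pair (`K`, cut of `K`) corresponds to a cut of `w` with a compatible composition of each part.
The flag at the cut imposes nothing, since the last flag of a block is free. -/
theorem convMul_ribbon (f g : WithConv (QSym l →ₗ[ℚ] ℚ)) (w : List (Fin l × Bool)) :
    (f * g) (ribbon w) = ∑ k ∈ Finset.range (w.length + 1),
      f (ribbon (w.take k)) * g (ribbon (w.drop k)) := by
  have h := apply_ribbon (f * g).ofConv w
  refine h.trans ?_
  have h1 : ∀ k, f (ribbon (w.take k)) * g (ribbon (w.drop k)) =
      ∑ p ∈ ((compositions (content letterDeg (w.take k))).filter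
          (fun K => Compat (w.take k) K.cols)) ×ˢ
        ((compositions (content letterDeg (w.drop k))).filter
          (fun K => Compat (w.drop k) K.cols)), f (M p.1) * g (M p.2) := by
    intro k
    rw [Finset.sum_product]
    refine Eq.trans ?_ (Finset.sum_mul_sum _ _ (fun A => f (M A)) fun B => g (M B))
    congr 1
    · exact apply_ribbon f.ofConv _
    · exact apply_ribbon g.ofConv _
  rw [Finset.sum_congr rfl fun k _ => h1 k, Finset.sum_congr rfl fun K _ => convMul_M f g K,
    Finset.sum_sigma', Finset.sum_sigma']
  refine Finset.sum_bij' (fun p _ => ⟨(p.1.take p.2).weight, (p.1.take p.2, p.1.drop p.2)⟩)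
    (fun p _ => ⟨p.2.1.append p.2.2, p.2.1.len⟩) ?_ ?_ ?_ ?_ ?_
  · rintro ⟨K, i⟩ hp
    rw [Finset.mem_sigma, mem_ribbon_index] at hp
    rw [Finset.mem_sigma, Finset.mem_product, mem_ribbon_index, mem_ribbon_index, Finset.mem_range]
    refine ⟨?_, hp.1.take_drop i⟩
    have h2 := (hp.1.take_drop i).1.weight_eq
    rw [List.length_take] at h2
    dsimp only at h2 ⊢
    omega
  · rintro ⟨k, A, B⟩ hp
    rw [Finset.mem_sigma, Finset.mem_product, mem_ribbon_index, mem_ribbon_index,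
      Finset.mem_range] at hp
    rw [Finset.mem_sigma, mem_ribbon_index, Finset.mem_range]
    constructor
    · have h2 := hp.2.1.append hp.2.2
      rw [List.take_append_drop] at h2
      exact h2
    · simp [len, VecComp.append]
  · rintro ⟨K, i⟩ hp
    rw [Finset.mem_sigma, Finset.mem_range] at hp
    have h2 : (K.take i).append (K.drop i) = K := VecComp.ext (List.take_append_drop i K.cols)
    have h3 : (K.take i).len = i := by
      rw [len_take]
      have := hp.2
      dsimp only at this
      omega
    dsimp only
    rw [h2, h3]
  · rintro ⟨k, A, B⟩ hp
    rw [Finset.mem_sigma, Finset.mem_product, mem_ribbon_index, mem_ribbon_index,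
      Finset.mem_range] at hp
    have h2 : (A.append B).take A.len = A := VecComp.ext List.take_left
    have h3 : (A.append B).drop A.len = B := VecComp.ext List.drop_left
    have h4 : A.weight = k := by
      have h5 := hp.2.1.weight_eq
      rw [List.length_take] at h5
      have := hp.1
      dsimp only at h5 this
      omega
    dsimp only
    rw [h2, h3, h4]
  · rintro ⟨K, i⟩ _
    rfl

theorem ribbon_mem (w : List (Fin l × Bool)) : ribbon w ∈ component (content letterDeg w) := by
  refine Submodule.sum_mem _ fun K hK => ?_
  rw [mem_ribbon_index] at hK
  rw [← hK.content_eq]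
  exact M_mem_component K

theorem compat_nil {K : VecComp l} : Compat [] K.cols ↔ K = empty := by
  constructor
  · intro h
    exact total_eq_zero.1 h.content_eq
  · rintro rfl
    exact ⟨[], rfl, rfl, by simp⟩

theorem convOne_ribbon (w : List (Fin l × Bool)) :
    (1 : WithConv (QSym l →ₗ[ℚ] ℚ)) (ribbon w) = if w = [] then 1 else 0 := by
  refine (apply_ribbon (1 : WithConv (QSym l →ₗ[ℚ] ℚ)).ofConv w).trans ?_
  rw [Finset.sum_congr rfl fun K _ => convOne_M K, Finset.sum_ite_eq']
  refine if_congr ?_ rfl rfl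
  rw [mem_ribbon_index]
  constructor
  · intro h
    exact List.length_eq_zero_iff.1 h.weight_eq.symm
  · rintro rfl
    exact compat_nil.2 rfl

/-- Evaluation keeps compositions with at most one column; the one-column one is compatible exactly
when `w` need not be cut. -/
theorem evalFirst_ribbon (ε : ℚ) (w : List (Fin l × Bool)) :
    evalFirst l ε (ribbon w) = if InitAll false (flags w) then ε ^ w.length else 0 := by
  refine (apply_ribbon (evalFirst l ε).toLinearMap w).trans ?_
  refine (Finset.sum_congr rfl fun K _ => evalFirst_M ε K).trans ?_
  by_cases hw : w = []
  · subst hw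
    rw [if_pos (show InitAll false (flags ([] : List (Fin l × Bool))) from initAll_nil _),
      Finset.sum_eq_single empty]
    · simp [len, weight, empty]
    · intro K hK hne
      exact absurd (compat_nil.1 (mem_ribbon_index.1 hK)) hne
    · intro h
      exact absurd (mem_ribbon_index.2 (compat_nil.2 rfl)) h
  · have hne : content letterDeg w ≠ 0 := fun h =>
      hw (eq_nil_of_content_eq_zero letterDeg_ne_zero h)
    let K₀ : VecComp l := ⟨[content letterDeg w], by simpa using hne⟩
    have h0 : Compat w K₀.cols ↔ InitAll false (flags w) := by
      constructor
      · rintro ⟨L, rfl, h, hL⟩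
        obtain ⟨x, hx⟩ : ∃ x, L = [x] := by
          have h1 := congrArg List.length h
          rw [List.length_map] at h1
          exact List.length_eq_one_iff.1 h1.symm
        subst hx
        simpa using hL x (by simp)
      · intro h
        exact ⟨[w], by simp, rfl, by simpa using h⟩
    have hlen : ∀ K : VecComp l, Compat w K.cols → K.len ≤ 1 → K = K₀ := by
      intro K hK hlen
      have h1 := hK.content_eq
      rcases Nat.le_one_iff_eq_zero_or_eq_one.1 hlen with h | h
      · rw [(eq_empty_iff K).2 h] at h1
        exact absurd h1.symm hne
      · obtain ⟨v, hv⟩ := List.length_eq_one_iff.1 h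
        refine VecComp.ext ?_
        rw [hv] at h1 ⊢
        change [v] = [content letterDeg w]
        rw [← h1, List.sum_singleton]
    by_cases hc : InitAll false (flags w)
    · rw [if_pos hc, Finset.sum_eq_single K₀]
      · rw [if_pos (show K₀.len ≤ 1 from le_refl 1), Compat.weight_eq (h0.2 hc)]
      · intro K hK hne'
        rw [if_neg fun h => hne' (hlen K (mem_ribbon_index.1 hK) h)]
      · intro h
        exact absurd (mem_ribbon_index.2 (h0.2 hc)) h
    · rw [if_neg hc]
      refine Finset.sum_eq_zero fun K hK => if_neg fun h => hc ?_
      have h1 := mem_ribbon_index.1 hK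
      rw [hlen K h1 h] at h1
      exact h0.1 h1

/-- The inverse relation determines the value on `w` from those on shorter prefixes, and the
vanishing of `cutSum (-1)` says that the claimed values satisfy the same recursion. -/
theorem antipodeChar_ribbon (w : List (Fin l × Bool)) :
    antipodeChar l (ribbon w) = if InitAll true (flags w) then 1 else 0 := by
  induction hn : w.length using Nat.strong_induction_on generalizing w with
  | _ n ih =>
    subst hn
    have hev : ∀ w, (toConv (evalFirst l (-1)).toLinearMap) (ribbon w) =
      if InitAll false (flags w) then (-1) ^ w.length else 0 := evalFirst_ribbon (-1)
    have h := convMul_ribbon (antipodeChar l) (toConv (evalFirst l (-1)).toLinearMap) w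
    have hnil : ∀ w : List (Fin l × Bool), InitAll false (flags (w.drop w.length)) := fun w => by
      rw [List.drop_length]
      exact initAll_nil _
    rw [antipodeChar_mul, convOne_ribbon, Finset.sum_range_succ, hev (w.drop _), if_pos (hnil w),
      List.take_length, List.drop_length, List.length_nil, pow_zero, mul_one] at h
    by_cases hw : w = []
    · subst hw
      rw [if_pos rfl, List.length_nil, Finset.sum_range_zero, zero_add] at h
      rw [← h]
      exact (if_pos (initAll_nil _)).symm
    · rw [if_neg hw] at h
      have h1 := cutSum_neg_one (fun h => hw (flags_eq_nil.1 h))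
      unfold cutSum at h1
      rw [length_flags, Finset.sum_range_succ] at h1
      have h2 : ∀ k ∈ Finset.range w.length,
          antipodeChar l (ribbon (w.take k)) *
            (toConv (evalFirst l (-1)).toLinearMap) (ribbon (w.drop k)) =
          (if InitAll true ((flags w).take k) then 1 else 0) *
            if InitAll false ((flags w).drop k) then (-1) ^ ((flags w).drop k).length else 0 := by
        intro k hk
        rw [Finset.mem_range] at hk
        rw [ih _ (by rw [List.length_take]; omega) (w.take k) rfl, hev]
        rw [flags_take, flags_drop, List.length_drop, List.length_drop, length_flags]
      rw [Finset.sum_congr rfl h2] at h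
      have h3 : (flags w).take w.length = flags w := by
        rw [← length_flags, List.take_length]
      have h4 : (flags w).drop w.length = [] := by
        rw [← length_flags, List.drop_length]
      rw [h3, h4, if_pos (initAll_nil _), List.length_nil, pow_zero, mul_one] at h1
      linarith

/-- The convolution is `cutSum 1` of the flags: two cuts survive when there is no peak, on either
side of the letter where the flags change. The product of ones is the trivial sign in the format of
`gradedProd_family`. -/
theorem nu_ribbon (w : List (Fin l × Bool)) (hw : w ≠ []) :
    nu (fun _ : Fin l => ⊤) (ribbon w) =
      if NoPeak (flags w) then 2 * (w.map fun _ => (1 : ℚ)).prod else 0 := by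
  have hev : ∀ w, (toConv (zeta l)) (ribbon w) =
      if InitAll false (flags w) then 1 ^ w.length else 0 := fun w => by
    rw [zeta_eq]
    exact evalFirst_ribbon 1 w
  have h1 := cutSum_one (fun h => hw (flags_eq_nil.1 h))
  have h2 : (2 : ℚ) * (w.map fun _ => (1 : ℚ)).prod = 2 := by simp
  rw [h2, ← h1]
  refine (convMul_ribbon (antipodeChar l) (toConv (zeta l)) w).trans ?_
  unfold cutSum
  rw [length_flags]
  refine Finset.sum_congr rfl fun k _ => ?_
  rw [antipodeChar_ribbon, hev]
  rw [flags_take, flags_drop, List.length_drop, List.length_drop, length_flags]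

theorem gradedProd_nu_ribbon (w : List (Fin l × Bool)) (J : VecComp l) :
    gradedProd (nu fun _ : Fin l => ⊤) J.cols (ribbon w) =
      if ∃ L : List (List (Fin l × Bool)), w = L.flatten ∧ J.cols = L.map (content letterDeg) ∧
        ∀ x ∈ L, NoPeak (flags x) then 2 ^ J.len else 0 := by
  have h := gradedProd_family letterDeg_ne_zero convMul_ribbon ribbon_mem convOne_ribbon
    nu_ribbon J.cols J.ne_zero w
  rw [h]
  refine if_congr Iff.rfl ?_ rfl
  simp [len]

/-! ### Quasi-ribbon functions as ribbons of coloring words -/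

/-- The increasing word with a given content. -/
def sortedWord (v : Fin l → ℕ) : List (Fin l) :=
  (List.finRange l).flatMap fun i => List.replicate (v i) i

theorem count_sortedWord (v : Fin l → ℕ) (i : Fin l) : (sortedWord v).count i = v i := by
  unfold sortedWord
  rw [List.count_flatMap]
  have h : (List.map (List.count i ∘ fun j => List.replicate (v j) j) (List.finRange l)).sum =
      ∑ j, if j = i then v j else 0 := by
    rw [← List.ofFn_id, List.map_ofFn, List.sum_ofFn]
    refine Finset.sum_congr rfl fun j _ => ?_
    simp [List.count_replicate]
  rw [h]
  simp

theorem mem_sortedWord {v : Fin l → ℕ} {i : Fin l} : i ∈ sortedWord v ↔ v i ≠ 0 := by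
  rw [← List.count_pos_iff, count_sortedWord, Nat.pos_iff_ne_zero]

theorem pairwise_sortedWord (v : Fin l → ℕ) : (sortedWord v).Pairwise (· ≤ ·) := by
  unfold sortedWord
  rw [List.pairwise_flatMap]
  refine ⟨fun i _ => List.pairwise_replicate.2 (Or.inr le_rfl), ?_⟩
  refine (List.pairwise_lt_finRange l).imp fun {i j} hij p hp q hq => ?_
  rw [List.eq_of_mem_replicate hp, List.eq_of_mem_replicate hq]
  exact hij.le

/-- The supports of the columns weakly increase. -/
def SuppIncreasingCols (K : List (Fin l → ℕ)) : Prop :=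
  K.Pairwise fun v w => ∀ p q : Fin l, v p ≠ 0 → w q ≠ 0 → p ≤ q

/-- Increasing supports make the concatenation sorted, and a sorted word is determined by its letter
counts. -/
theorem sortedWord_sum {K : List (Fin l → ℕ)} (hK : SuppIncreasingCols K) :
    sortedWord K.sum = (K.map sortedWord).flatten := by
  refine List.Perm.eq_of_pairwise (le := (· ≤ ·)) (fun a b _ _ h1 h2 => le_antisymm h1 h2)
    (pairwise_sortedWord _) ?_ ?_
  · rw [List.pairwise_flatten]
    constructor
    · intro x hx
      obtain ⟨v, -, rfl⟩ := List.mem_map.1 hx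
      exact pairwise_sortedWord v
    · rw [List.pairwise_map]
      exact hK.imp fun h p hp q hq => h p q (mem_sortedWord.1 hp) (mem_sortedWord.1 hq)
  · rw [List.perm_iff_count]
    intro i
    rw [count_sortedWord]
    clear hK
    induction K with
    | nil => simp
    | cons v K ih =>
      rw [List.sum_cons, List.map_cons, List.flatten_cons, List.count_append, ← ih,
        count_sortedWord, Pi.add_apply]

/-- Flag the last letter of a word. -/
def markLast {β : Type*} : List β → List (β × Bool)
  | [] => []
  | x :: t => (x, t.isEmpty) :: markLast t

theorem map_fst_markLast {β : Type*} (s : List β) : (markLast s).map Prod.fst = s := by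
  induction s with
  | nil => rfl
  | cons x t ih => simp [markLast, ih]

theorem map_snd_markLast {β : Type*} (s : List β) (hs : s ≠ []) :
    (markLast s).map Prod.snd = List.replicate (s.length - 1) false ++ [true] := by
  induction s with
  | nil => exact absurd rfl hs
  | cons x t ih =>
    cases t with
    | nil => rfl
    | cons y t =>
      rw [markLast, List.map_cons, ih (by simp)]
      simp [List.replicate_succ]

theorem initAll_replicate (n : ℕ) (x : Bool) : InitAll false (List.replicate n false ++ [x]) := by
  intro y hy
  rw [List.dropLast_concat] at hy
  exact List.eq_of_mem_replicate hy

theorem initAll_markLast (s : List (Fin l)) : InitAll false (flags (markLast s)) := by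
  by_cases hs : s = []
  · subst hs
    exact initAll_nil _
  · unfold flags
    rw [map_snd_markLast s hs]
    exact initAll_replicate _ _

/-- The increasing word of a column, with a descent marked at its end. -/
def colWord (v : Fin l → ℕ) : List (Fin l × Bool) := markLast (sortedWord v)

theorem content_single (s : List (Fin l)) (i : Fin l) :
    content (fun i : Fin l => (Pi.single i 1 : Fin l → ℕ)) s i = s.count i := by
  induction s with
  | nil => simp [content]
  | cons a s ih =>
    rw [content_cons, Pi.add_apply, ih, List.count_cons, Pi.single_apply, add_comm]
    congr 1
    refine if_congr ?_ rfl rfl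
    rw [beq_iff_eq, eq_comm]

theorem content_eq_content_fst (w : List (Fin l × Bool)) :
    content letterDeg w =
      content (fun i : Fin l => (Pi.single i 1 : Fin l → ℕ)) (w.map Prod.fst) := by
  unfold content
  rw [List.map_map]
  rfl

theorem content_of_fst {w : List (Fin l × Bool)} {v : Fin l → ℕ}
    (h : w.map Prod.fst = sortedWord v) : content letterDeg w = v := by
  funext i
  rw [content_eq_content_fst, h, content_single, count_sortedWord]

theorem content_colWord (v : Fin l → ℕ) : content letterDeg (colWord v) = v :=
  content_of_fst (map_fst_markLast _)

theorem length_sortedWord (v : Fin l → ℕ) : (sortedWord v).length = wt v := by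
  rw [← congrArg wt (content_colWord v), wt_content, colWord]
  conv_lhs => rw [← map_fst_markLast (sortedWord v)]
  rw [List.length_map]

theorem flags_colWord {v : Fin l → ℕ} (hv : v ≠ 0) :
    flags (colWord v) = List.replicate (wt v - 1) false ++ [true] := by
  have h : sortedWord v ≠ [] := by
    intro h
    have := one_le_wt hv
    rw [← length_sortedWord, h] at this
    simp at this
  unfold flags colWord
  rw [map_snd_markLast _ h, length_sortedWord]

theorem exists_split_of_map {β γ : Type*} (f : β → γ) (xs : List (List γ)) (w : List β)
    (h : w.map f = xs.flatten) : ∃ L : List (List β), w = L.flatten ∧ L.map (List.map f) = xs := by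
  induction xs generalizing w with
  | nil => exact ⟨[], by simpa using h, rfl⟩
  | cons x xs ih =>
    rw [List.flatten_cons, List.map_eq_append_iff] at h
    obtain ⟨w₁, w₂, rfl, h1, h2⟩ := h
    obtain ⟨L, rfl, rfl⟩ := ih w₂ h2
    exact ⟨w₁ :: L, rfl, by rw [List.map_cons, h1]⟩

/-- An inner letter of a factor is an inner letter of the whole word. -/
theorem initAll_of_mem_flatten {b : Bool} {L : List (List Bool)} (h : InitAll b L.flatten)
    {x : List Bool} (hx : x ∈ L) : InitAll b x := by
  obtain ⟨A, B, rfl⟩ := List.append_of_mem hx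
  intro y hy
  have hx0 : x ≠ [] := by
    rintro rfl
    simp at hy
  refine h y ?_
  rw [List.flatten_append, List.flatten_cons, List.dropLast_append_of_ne_nil (by simp [hx0])]
  refine List.mem_append_right _ ?_
  by_cases hB : B.flatten = []
  · rwa [hB, List.append_nil]
  · rw [List.dropLast_append_of_ne_nil hB]
    exact List.mem_append_left _ (List.mem_of_mem_dropLast hy)

/-- With its converse `Compat.suppIncreasing`: the ways of cutting a sorted word into pieces are the
refinements of its content with increasing supports. -/
theorem compat_colWord_sum {K : List (Fin l → ℕ)} (hK : SuppIncreasingCols K) :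
    Compat (colWord K.sum) K := by
  have h : (colWord K.sum).map Prod.fst = (K.map sortedWord).flatten := by
    rw [colWord, map_fst_markLast, sortedWord_sum hK]
  obtain ⟨L, hL, hL'⟩ := exists_split_of_map _ _ _ h
  refine ⟨L, hL, ?_, fun x hx => ?_⟩
  · refine List.ext_getElem ?_ fun i h1 h2 => ?_
    · have := congrArg List.length hL'
      simpa using this.symm
    · rw [List.getElem_map]
      refine (content_of_fst ?_).symm
      have h3 : (L.map (List.map Prod.fst))[i]'(by simpa using h2) = (K.map sortedWord)[i]'(by
        simpa using h1) := by simp only [hL']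
      rwa [List.getElem_map, List.getElem_map] at h3
  · have h3 := initAll_markLast (sortedWord K.sum)
    change InitAll false (flags (colWord K.sum)) at h3
    rw [hL, flags, List.map_flatten] at h3
    exact initAll_of_mem_flatten h3 (List.mem_map_of_mem hx)

theorem Compat.suppIncreasing {v : Fin l → ℕ} {K : List (Fin l → ℕ)} (h : Compat (colWord v) K) :
    SuppIncreasingCols K := by
  obtain ⟨L, hL, rfl, -⟩ := h
  have h1 : sortedWord v = (L.map (List.map Prod.fst)).flatten := by
    rw [← map_fst_markLast (sortedWord v)]
    change (colWord v).map Prod.fst = _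
    rw [hL, List.map_flatten]
  have h2 := pairwise_sortedWord v
  rw [h1, List.pairwise_flatten, List.pairwise_map] at h2
  unfold SuppIncreasingCols
  rw [List.pairwise_map]
  refine h2.2.imp fun {x y} hxy p q hp hq => ?_
  rw [content_eq_content_fst, content_single, Nat.ne_zero_iff_zero_lt, List.count_pos_iff] at hp hq
  exact hxy p hp q hq

/-- A block straddling the boundary would have the flag at the end of `w` among its inner flags. -/
theorem Compat.split {w w' : List (Fin l × Bool)} {K : List (Fin l → ℕ)} (h : Compat (w ++ w') K)
    (hw : ∃ f, flags w = f ++ [true]) :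
    ∃ A B, K = A ++ B ∧ Compat w A ∧ Compat w' B := by
  obtain ⟨L, hL, rfl, hflag⟩ := h
  have key : ∃ as bs, L = as ++ bs ∧ w = as.flatten ∧ w' = bs.flatten := by
    -- In the second case the boundary lies in the block `bs ++ c :: cs`; it is a genuine straddle
    -- unless `bs` is empty.
    rcases List.append_eq_flatten_iff.1 hL with h | ⟨as, bs, c, cs, ds, rfl, hw1, rfl⟩
    · exact h
    · by_cases hbs : bs = []
      · subst hbs
        exact ⟨as, (c :: cs) :: ds, rfl, by simpa using hw1, rfl⟩
      · exfalso
        obtain ⟨f, hf⟩ := hw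
        have h1 : flags bs ≠ [] := fun h => hbs (flags_eq_nil.1 h)
        have h2 : true ∈ flags bs := by
          have h3 : (flags w).getLast? = some true := by rw [hf]; simp
          rw [hw1, flags, List.map_append] at h3
          change (_ ++ flags bs).getLast? = _ at h3
          rw [List.getLast?_append_of_ne_nil _ h1] at h3
          exact List.mem_of_getLast? h3
        have h4 := hflag (bs ++ c :: cs) (by simp) true (by
          rw [flags, List.map_append, List.dropLast_append_of_ne_nil (by simp)]
          exact List.mem_append_left _ h2)
        simp at h4
  obtain ⟨as, bs, rfl, rfl, rfl⟩ := key
  refine ⟨as.map (content letterDeg), bs.map (content letterDeg), List.map_append,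
    ⟨as, rfl, rfl, fun x hx => hflag x (by simp [hx])⟩,
    ⟨bs, rfl, rfl, fun x hx => hflag x (by simp [hx])⟩⟩

/-- The coloring word with a descent marked at the end of each column. -/
def compWord (t : List (Fin l → ℕ)) : List (Fin l × Bool) := t.flatMap colWord

theorem map_fst_compWord (t : List (Fin l → ℕ)) :
    (compWord t).map Prod.fst = t.flatMap sortedWord := by
  unfold compWord
  rw [List.map_flatMap]
  congr 1
  funext v
  exact map_fst_markLast _

theorem content_compWord (t : List (Fin l → ℕ)) : content letterDeg (compWord t) = t.sum := by
  induction t with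
  | nil => rfl
  | cons v t ih =>
    rw [compWord, List.flatMap_cons, content_append, content_colWord, List.sum_cons, ← ih]
    rfl

theorem compat_compWord_iff {t K : List (Fin l → ℕ)} (ht : ∀ v ∈ t, v ≠ 0) (hK : ∀ v ∈ K, v ≠ 0) :
    Compat (compWord t) K ↔ ∃ Ks : List (List (Fin l → ℕ)), K = Ks.flatten ∧ t = Ks.map List.sum ∧
      ∀ A ∈ Ks, SuppIncreasingCols A := by
  constructor
  · intro h
    induction t generalizing K with
    | nil =>
      exact ⟨[], congrArg cols (compat_nil (K := ⟨K, hK⟩).1 h), rfl, by simp⟩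
    | cons v t ih =>
      obtain ⟨A, B, rfl, h1, h2⟩ := Compat.split (w := colWord v) (w' := compWord t) h
        ⟨_, flags_colWord (ht v (by simp))⟩
      obtain ⟨Ks, rfl, rfl, h3⟩ := ih (fun u hu => ht u (by simp [hu]))
        (fun u hu => hK u (by simp [hu])) h2
      refine ⟨A :: Ks, rfl, ?_, ?_⟩
      · rw [List.map_cons, h1.content_eq, content_colWord]
      · intro C hC
        rcases List.mem_cons.1 hC with rfl | hC
        · exact h1.suppIncreasing
        · exact h3 C hC
  · rintro ⟨Ks, rfl, rfl, h⟩
    clear ht hK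
    induction Ks with
    | nil => exact ⟨[], rfl, rfl, by simp⟩
    | cons A Ks ih =>
      have h1 := (compat_colWord_sum (h A (by simp))).append (ih fun C hC => h C (by simp [hC]))
      exact h1

theorem colorRefines_iff (I J : VecComp l) :
    I.ColorRefines J ↔ Compat (compWord I.cols) J.cols := by
  rw [compat_compWord_iff I.ne_zero J.ne_zero]
  constructor
  · rintro ⟨Js, h1, h2, h3⟩
    refine ⟨Js.map cols, h1, by rw [h2, List.map_map]; rfl, fun A hA => ?_⟩
    obtain ⟨K, hK, rfl⟩ := List.mem_map.1 hA
    exact h3 K hK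
  · rintro ⟨Ks, h1, h2, h3⟩
    have hne : ∀ x ∈ Ks, ∀ v ∈ x, v ≠ 0 := fun x hx v hv =>
      J.ne_zero v (h1 ▸ List.mem_flatten.2 ⟨x, hx, hv⟩)
    refine ⟨Ks.pmap (fun x hx => ⟨x, hx⟩) hne, ?_, ?_, fun K hK => ?_⟩
    · rw [List.map_pmap]
      simpa using h1
    · rw [List.map_pmap]
      simpa [total, List.pmap_eq_map] using h2
    · obtain ⟨x, hx, rfl⟩ := List.mem_pmap.1 hK
      exact h3 x hx

theorem F_eq_ribbon (I : VecComp l) : F I = ribbon (compWord I.cols) := by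
  unfold F ribbon
  rw [content_compWord]
  simp only [colorRefines_iff]
  rfl

/-! ### Peaks of flag sequences and of vector compositions -/

/-- There is a peak `r + 2`: a flag after letter `r + 2`, which is not the last one, and
none after letter `r + 1`. -/
def IsPeak (f : List Bool) (r : ℕ) : Prop :=
  f[r]? = some false ∧ f[r + 1]? = some true ∧ r + 2 < f.length

theorem isPeak_cons_zero (x : Bool) (f : List Bool) :
    IsPeak (x :: f) 0 ↔ x = false ∧ f[0]? = some true ∧ 1 < f.length := by
  simp only [IsPeak, List.getElem?_cons_zero, List.getElem?_cons_succ, Option.some.injEq,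
    List.length_cons]
  exact and_congr Iff.rfl (and_congr Iff.rfl (by omega))

theorem isPeak_cons_succ (x : Bool) (f : List Bool) (r : ℕ) :
    IsPeak (x :: f) (r + 1) ↔ IsPeak f r := by
  simp only [IsPeak, List.getElem?_cons_succ, List.length_cons]
  exact and_congr Iff.rfl (and_congr Iff.rfl (by omega))

theorem not_isPeak_nil (r : ℕ) : ¬ IsPeak [] r := by simp [IsPeak]

/-- After an initial `false`, the first inner `true` directly follows a `false` and is a peak. -/
theorem initAll_false_iff (f : List Bool) : InitAll false (false :: f) ↔
    ∀ r, ¬ IsPeak (false :: f) r := by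
  induction f with
  | nil => simp [initAll_singleton, IsPeak]
  | cons x f ih =>
    rw [initAll_cons_cons]
    constructor
    · rintro ⟨-, h⟩ r
      cases r with
      | zero =>
        rw [isPeak_cons_zero]
        rintro ⟨-, h1, h2⟩
        have hx : x = true := by simpa using h1
        subst hx
        have hf : f ≠ [] := by
          rintro rfl
          simp at h2
        rw [initAll_cons hf] at h
        simp at h
      | succ r =>
        rw [isPeak_cons_succ]
        by_cases hf : f = []
        · subst hf
          simp [IsPeak]
        · obtain ⟨rfl, -⟩ := (initAll_cons hf _ _).1 h
          exact ih.1 h r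
    · intro h
      refine ⟨rfl, ?_⟩
      by_cases hf : f = []
      · subst hf
        exact initAll_singleton _ _
      · have hx : x = false := by
          by_contra hx
          refine h 0 ((isPeak_cons_zero _ _).2 ⟨rfl, by simpa using hx, ?_⟩)
          have := List.length_pos_iff.2 hf
          simpa using this
        subst hx
        exact ih.2 fun r hr => h (r + 1) ((isPeak_cons_succ _ _ _).2 hr)

theorem noPeak_iff (f : List Bool) : NoPeak f ↔ ∀ r, ¬ IsPeak f r := by
  induction f with
  | nil => simp [NoPeak, not_isPeak_nil]
  | cons x f ih =>
    cases x
    · rw [← initAll_false_iff]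
      simp [NoPeak]
    · have h : NoPeak (true :: f) ↔ NoPeak f := by simp [NoPeak]
      rw [h, ih]
      constructor
      · intro h r
        cases r with
        | zero => simp [isPeak_cons_zero]
        | succ r =>
          rw [isPeak_cons_succ]
          exact h r
      · intro h r hr
        exact h (r + 1) ((isPeak_cons_succ _ _ _).2 hr)

/-- `s` is a proper partial sum of `ws`. -/
def IsPartialSum (ws : List ℕ) (s : ℕ) : Prop := ∃ A B, ws = A ++ B ∧ A ≠ [] ∧ B ≠ [] ∧ A.sum = s

theorem not_isPartialSum_nil (s : ℕ) : ¬ IsPartialSum [] s := by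
  rintro ⟨A, B, h, hA, -⟩
  exact hA (List.append_eq_nil_iff.1 h.symm).1

theorem isPartialSum_cons (a : ℕ) (ws : List ℕ) (s : ℕ) : IsPartialSum (a :: ws) s ↔
    ws ≠ [] ∧ (s = a ∨ ∃ s', IsPartialSum ws s' ∧ s = a + s') := by
  constructor
  · rintro ⟨A, B, h, hA, hB, rfl⟩
    obtain ⟨b, A, rfl⟩ := List.exists_cons_of_ne_nil hA
    rw [List.cons_append, List.cons.injEq] at h
    obtain ⟨rfl, rfl⟩ := h
    refine ⟨by simp [hB], ?_⟩
    by_cases hA' : A = []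
    · subst hA'
      exact Or.inl (by simp)
    · exact Or.inr ⟨A.sum, ⟨A, B, rfl, hA', hB, rfl⟩, List.sum_cons⟩
  · rintro ⟨hw, rfl | ⟨s', ⟨A, B, rfl, hA, hB, rfl⟩, rfl⟩⟩
    · exact ⟨[s], ws, rfl, by simp, hw, by simp⟩
    · exact ⟨a :: A, B, rfl, by simp, hB, List.sum_cons⟩

theorem mem_desSet (J : VecComp l) (s : ℕ) : s ∈ J.desSet ↔ IsPartialSum (J.cols.map wt) s := by
  unfold desSet
  rw [Finset.mem_image]
  constructor
  · rintro ⟨k, hk, rfl⟩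
    rw [Finset.mem_Ico] at hk
    refine ⟨(J.cols.map wt).take k, (J.cols.map wt).drop k, (List.take_append_drop _ _).symm,
      ?_, ?_, ?_⟩
    · intro h
      have := congrArg List.length h
      rw [List.length_take, List.length_map, List.length_nil] at this
      change min k J.len = 0 at this
      omega
    · intro h
      have := congrArg List.length h
      rw [List.length_drop, List.length_map, List.length_nil] at this
      change J.len - k = 0 at this
      omega
    · rw [← List.map_take]
      rfl
  · rintro ⟨A, B, h, hA, hB, rfl⟩
    have hlen : A.length + B.length = J.len := by
      rw [← List.length_append, ← h, List.length_map]
      rfl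
    have hA' := List.length_pos_iff.2 hA
    have hB' := List.length_pos_iff.2 hB
    refine ⟨A.length, Finset.mem_Ico.2 ⟨hA', by omega⟩, ?_⟩
    change ((J.cols.take A.length).map wt).sum = _
    rw [List.map_take, h, List.take_left]

/-- The flags are those of a column of weight `m + 1` and its successors. Its end is a peak when it
has an unflagged letter and is not the end of the word; no peak uses its flagged letter as the
unflagged one. -/
theorem isPeak_block (m : ℕ) (f : List Bool) (r : ℕ) :
    IsPeak (List.replicate m false ++ true :: f) r ↔
      (1 ≤ m ∧ r + 1 = m ∧ f ≠ []) ∨ ∃ r', r = m + 1 + r' ∧ IsPeak f r' := by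
  induction m generalizing r with
  | zero =>
    rw [List.replicate_zero, List.nil_append]
    cases r with
    | zero =>
      rw [isPeak_cons_zero]
      constructor
      · rintro ⟨h, -⟩
        simp at h
      · rintro (h | ⟨r', h, -⟩) <;> omega
    | succ r =>
      rw [isPeak_cons_succ]
      constructor
      · exact fun h => Or.inr ⟨r, by omega, h⟩
      · rintro (h | ⟨r', h, h'⟩)
        · omega
        · obtain rfl : r = r' := by omega
          exact h'
  | succ m ih =>
    rw [List.replicate_succ, List.cons_append]
    cases r with
    | zero =>
      rw [isPeak_cons_zero]
      cases m with
      | zero =>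
        constructor
        · rintro ⟨-, -, h⟩
          refine Or.inl ⟨le_rfl, rfl, ?_⟩
          rintro rfl
          simp at h
        · rintro (⟨-, -, h⟩ | ⟨r', h, -⟩)
          · refine ⟨rfl, rfl, ?_⟩
            have := List.length_pos_iff.2 h
            simpa using this
          · omega
      | succ m =>
        constructor
        · rintro ⟨-, h, -⟩
          simp [List.replicate_succ] at h
        · rintro (h | ⟨r', h, -⟩) <;> omega
    | succ r =>
      rw [isPeak_cons_succ, ih]
      constructor
      · rintro (⟨h1, h2, h3⟩ | ⟨r', h, h'⟩)
        · exact Or.inl ⟨by omega, by omega, h3⟩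
        · exact Or.inr ⟨r', by omega, h'⟩
      · rintro (⟨h1, h2, h3⟩ | ⟨r', h, h'⟩)
        · exact Or.inl ⟨by omega, by omega, h3⟩
        · exact Or.inr ⟨r', by omega, h'⟩

theorem wt_add (v w : Fin l → ℕ) : wt (v + w) = wt v + wt w := by
  simp [wt, Finset.sum_add_distrib]

theorem peakCols_zero_eq_nil {t : List (Fin l → ℕ)} (ht : ∀ v ∈ t, v ≠ 0) :
    peakCols 0 t = [] ↔ t = [] := by
  have h : ∀ (t : List (Fin l → ℕ)), (∀ v ∈ t, v ≠ 0) → ∀ acc : Fin l → ℕ, acc ≠ 0 →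
      peakCols acc t ≠ [] := by
    intro t
    induction t with
    | nil =>
      intro _ acc h
      simp [peakCols, h]
    | cons v t ih =>
      intro ht acc _
      unfold peakCols
      split_ifs
      · simp
      · exact ih (fun u hu => ht u (by simp [hu])) _ (add_ne_zero_right _ (ht v (by simp)))
  constructor
  · intro h0
    cases t with
    | nil => rfl
    | cons v t =>
      exfalso
      unfold peakCols at h0
      split_ifs at h0
      exact h t (fun u hu => ht u (by simp [hu])) _ (add_ne_zero_right _ (ht v (by simp))) h0
  · rintro rfl
    simp [peakCols]

theorem flags_compWord_cons {v : Fin l → ℕ} (hv : v ≠ 0) (t : List (Fin l → ℕ)) :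
    flags (compWord (v :: t)) =
      List.replicate (wt v - 1) false ++ true :: flags (compWord t) := by
  rw [compWord, List.flatMap_cons, flags, List.map_append]
  change flags (colWord v) ++ _ = _
  rw [flags_colWord hv, List.append_assoc]
  rfl

theorem flags_compWord_eq_nil {t : List (Fin l → ℕ)} (ht : ∀ v ∈ t, v ≠ 0) :
    flags (compWord t) = [] ↔ t = [] := by
  cases t with
  | nil => simp [compWord, flags]
  | cons v t =>
    rw [flags_compWord_cons (ht v (by simp))]
    simp

/-- Blocks of `Λ` close at columns of weight at least two, and these are where a flagged letter
follows an unflagged one. The end of the word is excluded on both sides; `acc` shifts positions by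
the letters already read. -/
theorem isPartialSum_peakCols {t : List (Fin l → ℕ)} (ht : ∀ v ∈ t, v ≠ 0) (acc : Fin l → ℕ)
    (s : ℕ) : IsPartialSum ((peakCols acc t).map wt) s ↔
      ∃ r, s = wt acc + r + 2 ∧ IsPeak (flags (compWord t)) r := by
  induction t generalizing acc s with
  | nil =>
    constructor
    · intro h
      exfalso
      unfold peakCols at h
      split_ifs at h
      · exact not_isPartialSum_nil _ h
      · exact ((isPartialSum_cons _ _ _).1 h).1 rfl
    · rintro ⟨r, -, h⟩
      exact absurd h (not_isPeak_nil r)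
  | cons v t ih =>
    have hv := ht v (by simp)
    have ht' : ∀ u ∈ t, u ≠ 0 := fun u hu => ht u (by simp [hu])
    have hw := one_le_wt hv
    rw [flags_compWord_cons hv]
    simp only [isPeak_block]
    unfold peakCols
    by_cases h1 : wt v = 1
    · rw [if_neg (not_not.2 h1), ih ht', wt_add]
      constructor
      · rintro ⟨r, rfl, h⟩
        exact ⟨r + 1, by omega, Or.inr ⟨r, by omega, h⟩⟩
      · rintro ⟨r, rfl, h | ⟨r', h, h'⟩⟩
        · omega
        · exact ⟨r', by omega, h'⟩
    · have h0 : wt (0 : Fin l → ℕ) = 0 := by simp [wt]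
      rw [if_pos h1, List.map_cons, isPartialSum_cons, ne_eq, List.map_eq_nil_iff,
        peakCols_zero_eq_nil ht', wt_add, ne_eq, flags_compWord_eq_nil ht']
      simp only [ih ht', h0, zero_add]
      constructor
      · rintro ⟨hne, rfl | ⟨s', ⟨r, rfl, h⟩, rfl⟩⟩
        -- The peak is the last letter of the column `v`, and positions are counted as `r + 2`.
        · exact ⟨wt v - 2, by omega, Or.inl ⟨by omega, by omega, hne⟩⟩
        · exact ⟨wt v + r, by omega, Or.inr ⟨r, by omega, h⟩⟩
      · rintro ⟨r, rfl, ⟨h2, h3, h4⟩ | ⟨r', h, h'⟩⟩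
        · exact ⟨h4, Or.inl (by omega)⟩
        · refine ⟨?_, Or.inr ⟨r' + 2, ⟨r', rfl, h'⟩, by omega⟩⟩
          rintro rfl
          exact not_isPeak_nil r' h'

theorem mem_peakSet (I : VecComp l) (s : ℕ) :
    s ∈ I.peakSet ↔ ∃ r, s = r + 2 ∧ IsPeak (flags (compWord I.cols)) r := by
  unfold peakSet
  rw [mem_desSet]
  refine (isPartialSum_peakCols I.ne_zero 0 s).trans ?_
  simp [wt]

theorem isPeak_append_left {f g : List Bool} {r : ℕ} (h : r + 2 < f.length) :
    IsPeak (f ++ g) r ↔ IsPeak f r := by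
  unfold IsPeak
  rw [List.getElem?_append_left (by omega), List.getElem?_append_left (by omega),
    List.length_append]
  refine and_congr Iff.rfl (and_congr Iff.rfl ⟨fun _ => h, fun _ => by omega⟩)

theorem isPeak_append_right (f g : List Bool) (r : ℕ) :
    IsPeak (f ++ g) (f.length + r) ↔ IsPeak g r := by
  unfold IsPeak
  rw [List.getElem?_append_right (by omega), List.getElem?_append_right (by omega),
    List.length_append]
  have h1 : f.length + r - f.length = r := by omega
  have h2 : f.length + r + 1 - f.length = r + 1 := by omega
  rw [h1, h2]
  refine and_congr Iff.rfl (and_congr Iff.rfl ⟨fun h => by omega, fun h => by omega⟩)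

/-- The peak `r + 2` involves the letters `r + 1`, `r + 2` and `r + 3`. It survives inside a block
unless there is a cut after letter `r + 1` or after letter `r + 2`. Conversely, peaks of blocks are
peaks of the concatenation. -/
theorem noPeak_blocks_iff {L : List (List Bool)} (hL : ∀ x ∈ L, x ≠ []) :
    (∀ x ∈ L, NoPeak x) ↔ ∀ r, IsPeak L.flatten r →
      IsPartialSum (L.map List.length) (r + 2) ∨ IsPartialSum (L.map List.length) (r + 1) := by
  induction L with
  | nil => simp [not_isPeak_nil]
  | cons x L ih =>
    rw [List.forall_mem_cons, noPeak_iff, ih fun y hy => hL y (by simp [hy]), List.flatten_cons,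
      List.map_cons]
    simp only [isPartialSum_cons]
    by_cases hL0 : L = []
    · subst hL0
      simp [not_isPeak_nil]
    · have hmap : L.map List.length ≠ [] := by simpa using hL0
      simp only [hmap, ne_eq, not_false_eq_true, true_and]
      constructor
      · rintro ⟨h1, h2⟩ r hr
        rcases lt_or_ge (r + 2) x.length with h | h
        · exact absurd ((isPeak_append_left h).1 hr) (h1 r)
        · rcases Nat.eq_or_lt_of_le h with h | h
          · exact Or.inl (Or.inl h.symm)
          · rcases Nat.eq_or_lt_of_le (Nat.le_of_lt_succ h) with h | h
            · exact Or.inr (Or.inl h.symm)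
            · obtain ⟨r', rfl⟩ := Nat.exists_eq_add_of_le (Nat.le_of_lt_succ h)
              rcases h2 r' ((isPeak_append_right _ _ _).1 hr) with h3 | h3
              · exact Or.inl (Or.inr ⟨_, h3, by omega⟩)
              · exact Or.inr (Or.inr ⟨_, h3, by omega⟩)
      · intro h
        constructor
        · intro r hr
          have hlt := hr.2.2
          rcases h r ((isPeak_append_left hlt).2 hr) with (h1 | ⟨s, -, h1⟩) | (h1 | ⟨s, -, h1⟩) <;>
            omega
        · intro r hr
          rcases h _ ((isPeak_append_right x _ r).2 hr) with (h1 | ⟨s, hs, h1⟩) | (h1 | ⟨s, hs, h1⟩)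
          · omega
          · left
            rwa [show r + 2 = s by omega]
          · omega
          · right
            rwa [show r + 1 = s by omega]

/-! ### The map on quasi-ribbon functions -/

theorem peakSet_subset_iff {I J : VecComp l} {L : List (List (Fin l × Bool))}
    (hL : compWord I.cols = L.flatten) (hJ : J.cols = L.map (content letterDeg)) :
    (∀ x ∈ L, NoPeak (flags x)) ↔ I.peakSet ⊆ J.desSet ∪ J.desSet.image (· + 1) := by
  have h0 : ∀ x ∈ L.map flags, x ≠ [] := by
    intro x hx h
    obtain ⟨y, hy, rfl⟩ := List.mem_map.1 hx
    rw [flags_eq_nil] at h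
    subst h
    -- An empty block would produce a zero column of `J`.
    exact J.ne_zero 0 (hJ ▸ List.mem_map.2 ⟨[], hy, rfl⟩) rfl
  have h1 := noPeak_blocks_iff h0
  rw [List.forall_mem_map] at h1
  rw [h1]
  have h2 : (L.map flags).flatten = flags (compWord I.cols) := by
    rw [hL, flags, List.map_flatten]
    rfl
  have h3 : (L.map flags).map List.length = J.cols.map wt := by
    rw [hJ, List.map_map, List.map_map]
    refine List.map_congr_left fun x _ => ?_
    rw [Function.comp_apply, Function.comp_apply, wt_content, length_flags]
  rw [h2, h3]
  simp only [Finset.subset_iff, Finset.mem_union, Finset.mem_image, mem_desSet, mem_peakSet]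
  constructor
  · rintro h s ⟨r, rfl, hr⟩
    rcases h r hr with h | h
    · exact Or.inl h
    · exact Or.inr ⟨_, h, rfl⟩
  · intro h r hr
    rcases h ⟨r, rfl, hr⟩ with h | ⟨s, h, h'⟩
    · exact Or.inl h
    · right
      rwa [show r + 1 = s by omega]

/-- Flags play no role here: grouping the coordinate columns is factoring the coloring word, and the
factorization lifts to the flagged word. -/
theorem refines_coord_iff (I J : VecComp l) : J.Refines (coord I.colorWord) ↔
    ∃ L : List (List (Fin l × Bool)), compWord I.cols = L.flatten ∧
      J.cols = L.map (content letterDeg) := by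
  have hw : (compWord I.cols).map Prod.fst = I.colorWord := map_fst_compWord _
  have hc : (coord I.colorWord).cols = (compWord I.cols).map letterDeg := by
    change I.colorWord.map _ = _
    rw [← hw, List.map_map]
    rfl
  rw [refines_iff, hc]
  constructor
  · rintro ⟨K, h1, h2⟩
    obtain ⟨L, h3, rfl⟩ := exists_split_of_map _ _ _ h1
    refine ⟨L, h3, ?_⟩
    rw [h2, List.map_map]
    rfl
  · rintro ⟨L, h1, h2⟩
    refine ⟨L.map (List.map letterDeg), by rw [h1, List.map_flatten], ?_⟩
    rw [h2, List.map_map]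
    rfl

theorem lift_nu_F (I : VecComp l) : lift (nu fun _ : Fin l => ⊤) (F I) =
    ∑ J ∈ VecComp.compositions I.total with
      J.Refines (VecComp.coord I.colorWord) ∧
        I.peakSet ⊆ J.desSet ∪ J.desSet.image (· + 1),
      (2 : ℚ) ^ J.len • M J := by
  refine coord_ext fun J => ?_
  refine (LinearMap.congr_fun (coord_lift _ J) _).trans ?_
  rw [F_eq_ribbon]
  refine (gradedProd_nu_ribbon (compWord I.cols) J).trans ?_
  rw [map_sum]
  simp only [map_smul, coord_M, smul_eq_mul, mul_ite, mul_one, mul_zero]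
  rw [Finset.sum_ite_eq']
  refine if_congr ?_ rfl rfl
  rw [Finset.mem_filter, mem_compositions, refines_coord_iff]
  constructor
  · rintro ⟨L, h1, h2, h3⟩
    refine ⟨?_, ⟨L, h1, h2⟩, (peakSet_subset_iff h1 h2).1 h3⟩
    unfold total
    rw [h2, ← content_flatten, ← h1, content_compWord]
  · rintro ⟨-, ⟨L, h1, h2⟩, h3⟩
    exact ⟨L, h1, h2, (peakSet_subset_iff h1 h2).2 h3⟩

end QSym

end

theorem propositionP (l : ℕ) (hl : 0 < l) :
    ∃ Θ : QSym l →ₗc[ℚ] QSym l,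
      (QSym.IsDescentsToPeaks (fun _ => ⊤) Θ ∧
        ∀ Θ' : QSym l →ₗc[ℚ] QSym l, QSym.IsDescentsToPeaks (fun _ => ⊤) Θ' → Θ' = Θ) ∧
      (∀ I : VecComp l, Θ (QSym.M I) =
        if I = VecComp.empty then 1
        else if I.LastOdd then (-1 : ℚ) ^ (I.len + I.weight) • QSym.eta I.odd
        else 0) ∧
      (∀ I : VecComp l, Θ (QSym.F I) =
        ∑ J ∈ VecComp.compositions I.total with
            J.Refines (VecComp.coord I.colorWord) ∧
              I.peakSet ⊆ J.desSet ∪ J.desSet.image (· + 1),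
          (2 : ℚ) ^ J.len • QSym.M J) := by
  refine ⟨QSym.liftHom QSym.zeta_M (QSym.nu fun _ => ⊤), ⟨⟨?_, ?_⟩, ?_⟩, ?_, ?_⟩
  · exact fun n f hf => QSym.lift_mem _ hf
  · exact QSym.zeta_comp_lift QSym.zeta_M QSym.nu_M_empty
  · exact fun Θ' h => QSym.eq_liftHom QSym.zeta_M h.1 h.2
  · exact QSym.lift_nu_M
  · exact QSym.lift_nu_F
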